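/- **Setting.** Proposition letters and variables are drawn from a fixed countably infinite set; $\mathsf P$ ranges over its finite subsets. A *one-step language* $L_1$ assigns to every finite set $A$ of monadic predicates a collection $L_1(A)$ of formulas, each with a set of predicates occurring in it, together with a truth relation $(D,V)\models\alpha$ for sets $D$ (possibly empty) and valuations $V:A\to\wp(D)$, which depends only on the $V(a)$ with $a$ occurring in $\alpha$. It comes with fragments $L_1^+(A)$, $\mathrm{Con}_B(L_1(A))$, $\mathrm{Cocon}_B(L_1(A))$ ($B\subseteq A$) of formulas that are, respectively, monotone in $A$, $B$-continuous (monotone in $B$, and whenever true under $V$, still true after shrinking the sets $V(b)$, $b\in B$, to suitable finite subsets), and $B$-cocontinuous (the boolean dual is $B$-continuous). For the word "effective" one-step formulas are given by an injective numbering for which it is decidable whether a predicate occurs in a formula. An *$L_1$-automaton* over $\mathsf P$ is $\mathbb A=\langle A,\Delta,\Omega,a_I\rangle$ with $A$ finite, $a_I\in A$, $\Delta:A\times\wp(\mathsf P)\to L_1^+(A)$, $\Omega:A\to\mathbb N$. It accepts a $\mathsf P$-labelled transition system $\mathbb S=\langle T,R,\kappa,s_I\rangle$ iff $\exists$ has a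 winning strategy from $(a_I,s_I)$ in the parity game (max-parity, even wins for $\exists$) in which at $(a,s)$, of priority $\Omega(a)$, $\exists$ picks $V:A\to\wp(R[s])$ with $(R[s],V)\models\Delta(a,\kappa(s))$, and at $V$, of priority $0$, $\forall$ picks $(b,t)$ with $t\in V(b)$. Let $\prec$ be the transitive closure of $\{(a,b): b\text{ occurs in }\Delta(a,c)\text{ for some }c\}$; *clusters* are the classes of the equivalence relation generated by $\prec\cap\succ$. $\mathbb A$ is *weak* if $\Omega$ is constant on clusters. $\mathbb A$ is *weak-continuous* if it is weak, $\Omega$ takes values in $\{0,1\}$, and for every cluster $M$, $a\in M$ and $c\in\wp(\mathsf P)$: $\Delta(a,c)\in\mathrm{Con}_M(L_1(A))$ if $\Omega(a)=1$, and $\Delta(a,c)\in\mathrm{Cocon}_M(L_1(A))$ if $\Omega(a)=0$. The language $\mu L_1$ is given by $$\varphi ::= q\mid\neg q\mid\varphi\vee\varphi\mid\varphi\wedge\varphi\mid\bigcirc_\alpha(\varphi_1,\dots,\varphi_n)\mid\mu p.\varphi'\mid\nu p.\varphi'$$ with $\alpha(a_1,\dots,a_n)\in L_1^+$ and $\varphi'$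 monotone in $p$. The semantics is standard, with $\bigcirc_\alpha(\bar\varphi)$ true at $s$ iff $(R[s],V)\models\alpha$ where $V(a_i)$ is the set of $t\in R[s]$ satisfying $\varphi_i$. For a set $Q$ of letters, the formulas *noetherian* in $Q$ are generated by $$\varphi::=q\mid\psi\mid\varphi\vee\varphi\mid\varphi\wedge\varphi\mid\bigcirc_\alpha(\varphi_1,\dots,\varphi_n)\mid\mu p.\varphi',$$ where $q\in Q$, $\psi\in\mu L_1$ is $Q$-free (no letter of $Q$ is free in it), $\alpha\in L_1^+$ and $\varphi'$ is noetherian in $Q\cup\{p\}$. The formulas *continuous* in $Q$ are generated by the same grammar with $\varphi'$ continuous in $Q\cup\{p\}$ and with the modal clause $\bigcirc_\alpha(\varphi_1,\dots,\varphi_k,\psi_1,\dots,\psi_m)$, where the $\psi_j\in\mu L_1$ are $Q$-free and $\alpha(\bar a,\bar b)\in L_1^+$ lies in $\mathrm{Con}_{\bar a}(L_1)$. *Co-noetherian* and *co-continuous* are defined dually ($\nu$ for $\mu$, $\mathrm{Cocon}$ for $\mathrm{Con}$). $\mu_D L_1$ is given by the grammar of $\mu L_1$, where $\mu p.\varphi'$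 ($\nu p.\varphi'$) may be formed only if $\varphi'\in\mu_DL_1$ is noetherian (co-noetherian) in $\{p\}$; $\mu_C L_1$ is defined likewise with continuous (co-continuous). **Theorem.** Let $L_1$ be a one-step language. There is an effective procedure that, given a finite set $\mathsf P$ and an $L_1$-automaton $\mathbb A$ over $\mathsf P$, returns a formula $\xi_{\mathbb A}\in\mu L_1$ with free variables in $\mathsf P$ such that 1. $\xi_{\mathbb A}$ is equivalent to $\mathbb A$: for every $\mathsf P$-labelled transition system $\mathbb S$, $\mathbb S\Vdash\xi_{\mathbb A}$ iff $\mathbb A$ accepts $\mathbb S$; 2. $\xi_{\mathbb A}\in\mu_D L_1$ if $\mathbb A$ is weak; 3. $\xi_{\mathbb A}\in\mu_C L_1$ if $\mathbb A$ is weak-continuous. -/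

import Mathlib

open Set Filter

universe u v

/-! ### One-step languages -/

/-- A property of one-step models `(D, V)` over the predicates `a_0, …, a_{n-1}`. -/
abbrev OneStepProp (n : ℕ) : Type (u + 1) := (D : Type u) → (Fin n → Set D) → Prop

namespace OneStepProp

/-- `V'` is a `B`-extension of `V`, written `V ≤_B V'`. -/
def Ext {n : ℕ} {D : Type u} (B : Set (Fin n)) (V V' : Fin n → Set D) : Prop :=
  (∀ b ∈ B, V b ⊆ V' b) ∧ ∀ a, a ∉ B → V a = V' a

/-- Monotonicity in `B`. -/
def MonotoneIn {n : ℕ} (B : Set (Fin n)) (Q : OneStepProp.{u} n) : Prop :=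
  ∀ (D : Type u) (V V' : Fin n → Set D), Ext B V V' → Q D V → Q D V'

/-- `B`-continuity. -/
def ContinuousIn {n : ℕ} (B : Set (Fin n)) (Q : OneStepProp.{u} n) : Prop :=
  MonotoneIn B Q ∧ ∀ (D : Type u) (V : Fin n → Set D), Q D V →
    ∃ V' : Fin n → Set D, Ext B V' V ∧ Q D V' ∧ ∀ b ∈ B, (V' b).Finite

/-- The boolean dual: it holds in `(D, V)` iff `Q` fails in `(D, Vᶜ)`. -/
def dual {n : ℕ} (Q : OneStepProp.{u} n) : OneStepProp.{u} n :=
  fun D V => ¬ Q D (fun a => (V a)ᶜ)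

/-- `B`-cocontinuity: the boolean dual is `B`-continuous. -/
def CocontinuousIn {n : ℕ} (B : Set (Fin n)) (Q : OneStepProp.{u} n) : Prop :=
  ContinuousIn B (dual Q)

end OneStepProp

/-- A one-step language `L₁` together with its isolated monotone, continuous and cocontinuous
fragments. A finite set of monadic predicates is presented as `Fin n`, so `Form n` is
`L₁({a_0, …, a_{n-1}})`. -/
structure OneStepLanguage where
  /-- the one-step formulas over `n` monadic predicates -/
  Form : ℕ → Type v
  /-- the predicates that occur in a formula -/
  occ : {n : ℕ} → Form n → Set (Fin n)
  /-- the truth relation `(D, V) ⊨ α` (the empty domain is allowed) -/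
  Truth : {n : ℕ} → Form n → OneStepProp.{u} n
  /-- truth depends only on the interpretation of the predicates that occur in the formula -/
  truth_congr : ∀ {n : ℕ} (α : Form n) (D : Type u) (V V' : Fin n → Set D),
    (∀ a ∈ occ α, V a = V' a) → (Truth α D V ↔ Truth α D V')
  /-- the fragment `L₁⁺` -/
  pos : (n : ℕ) → Set (Form n)
  /-- the fragments `Con_B(L₁)` -/
  con : {n : ℕ} → Set (Fin n) → Set (Form n)
  /-- the fragments `Cocon_B(L₁)` -/
  cocon : {n : ℕ} → Set (Fin n) → Set (Form n)
  pos_monotone : ∀ {n : ℕ} (α : Form n), α ∈ pos n → (Truth α).MonotoneIn Set.univ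
  con_continuous : ∀ {n : ℕ} (B : Set (Fin n)) (α : Form n), α ∈ con B →
    (Truth α).ContinuousIn B
  cocon_cocontinuous : ∀ {n : ℕ} (B : Set (Fin n)) (α : Form n), α ∈ cocon B →
    (Truth α).CocontinuousIn B

/-! ### Transition systems and parity games -/

/-- Transition systems labelled by a finite set `P` of proposition letters (proposition letters are
natural numbers). -/
structure LTS (P : Finset ℕ) where
  T : Type u
  R : T → T → Prop
  κ : T → P.powerset
  init : T

/-- The colouring of a transition system, seen as a valuation of the proposition letters. -/
def LTS.val {P : Finset ℕ} (S : LTS.{u} P) : ℕ → Set S.T :=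
  fun p => {s | p ∈ (S.κ s).1}

/-- Parity games: `isE` marks the positions of `∃`, all other positions belong to `∀`. -/
structure ParityGame (G : Type u) where
  isE : G → Prop
  move : G → G → Prop
  prio : G → ℕ

namespace ParityGame

/-- The initial segment `u_0, …, u_k` of a sequence of positions. -/
def history {G : Type u} (w : ℕ → G) (k : ℕ) : List G := (List.range (k + 1)).map w

/-- `w_0, …, w_k` is a match that is guided by the strategy `f` of `∃`. -/
def Guided {G : Type u} (𝒢 : ParityGame G) (f : List G → G) (w : ℕ → G) (k : ℕ) : Prop :=
  ∀ i < k, 𝒢.move (w i) (w (i + 1)) ∧ (𝒢.isE (w i) → w (i + 1) = f (history w i))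

/-- The maximal priority that is reached infinitely often exists and is even. -/
def ParityWin {G : Type u} (𝒢 : ParityGame G) (w : ℕ → G) : Prop :=
  ∃ m : ℕ, Even m ∧ (∃ᶠ i in atTop, 𝒢.prio (w i) = m) ∧
    ∀ m' : ℕ, (∃ᶠ i in atTop, 𝒢.prio (w i) = m') → m' ≤ m

/-- `f` is a winning strategy for `∃` from position `x`: at the end of any finite guided match in
which `∃` has to move, `f` provides an admissible move (so `∃` never gets stuck), and `∃` wins all
infinite guided matches. -/
def WinningStrategy {G : Type u} (𝒢 : ParityGame G) (x : G) (f : List G → G) : Prop :=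
  ∀ w : ℕ → G, w 0 = x →
    (∀ k, 𝒢.Guided f w k → 𝒢.isE (w k) → 𝒢.move (w k) (f (history w k))) ∧
    ((∀ k, 𝒢.Guided f w k) → 𝒢.ParityWin w)

/-- `x` is a winning position for `∃`. -/
def WinningE {G : Type u} (𝒢 : ParityGame G) (x : G) : Prop :=
  ∃ f : List G → G, 𝒢.WinningStrategy x f

end ParityGame

namespace OneStepLanguage

/-! ### Parity automata -/

/-- `L₁`-automata over `P`. The finite nonempty state set is `{0, …, n-1}`. -/
structure Automaton (L : OneStepLanguage.{u, v}) (P : Finset ℕ) where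
  n : ℕ
  Δ : Fin n → P.powerset → L.Form n
  Δ_pos : ∀ a c, Δ a c ∈ L.pos n
  Ω : Fin n → ℕ
  init : Fin n

namespace Automaton

variable {L : OneStepLanguage.{u, v}} {P : Finset ℕ}

/-- The acceptance game. Positions are the pairs `(a, s)`, where `∃` chooses a valuation, and
valuations `V : A → ℘(T)`, where `∀` chooses a pair `(b, t)` with `t ∈ V(b)`. -/
def acceptanceGame (A : L.Automaton P) (S : LTS.{u} P) :
    ParityGame ((Fin A.n × S.T) ⊕ (Fin A.n → Set S.T)) where
  isE x := x.isLeft = true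
  move x y :=
    match x, y with
    | .inl (a, s), .inr V =>
        (∀ b, V b ⊆ {t | S.R s t}) ∧
        L.Truth (A.Δ a (S.κ s)) {t // S.R s t} (fun b => {t | t.1 ∈ V b})
    | .inr V, .inl (b, t) => t ∈ V b
    | _, _ => False
  prio x :=
    match x with
    | .inl (a, _) => A.Ω a
    | .inr _ => 0

/-- `A` accepts `S`. -/
def Accepts (A : L.Automaton P) (S : LTS.{u} P) : Prop :=
  (A.acceptanceGame S).WinningE (.inl (A.init, S.init))

/-- `a ≺ b`: the transitive closure of the occurrence relation. -/
def Prec (A : L.Automaton P) : Fin A.n → Fin A.n → Prop :=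
  Relation.TransGen (fun a b => ∃ c, b ∈ L.occ (A.Δ a c))

/-- The cluster of `a`: its class in the equivalence relation generated by `≺ ∩ ≻`, which is the
reflexive closure of that symmetric and transitive relation. -/
def cluster (A : L.Automaton P) (a : Fin A.n) : Set (Fin A.n) :=
  {b | b = a ∨ (A.Prec a b ∧ A.Prec b a)}

/-- Weakness: priorities are constant on clusters. -/
def IsWeak (A : L.Automaton P) : Prop :=
  ∀ a, ∀ b ∈ A.cluster a, A.Ω a = A.Ω b

/-- Weak-continuous automata: weak automata with priorities in `{0, 1}` that satisfy the continuity
condition. -/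
def IsWeakContinuous (A : L.Automaton P) : Prop :=
  A.IsWeak ∧ (∀ a, A.Ω a ≤ 1) ∧
  ∀ a c, (A.Ω a = 1 → A.Δ a c ∈ L.con (A.cluster a)) ∧
         (A.Ω a = 0 → A.Δ a c ∈ L.cocon (A.cluster a))

end Automaton

/-! ### The `μ`-calculus over a one-step language -/

/-- Raw formulas. In `nxt α φ` the predicate `a_i` of `α` is replaced by the formula `φ i`. -/
inductive Fml (L : OneStepLanguage.{u, v}) : Type v
  | var (q : ℕ) : Fml L
  | neg (q : ℕ) : Fml L
  | or (φ ψ : Fml L) : Fml L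
  | and (φ ψ : Fml L) : Fml L
  | nxt {n : ℕ} (α : L.Form n) (φ : Fin n → Fml L) : Fml L
  | mu (p : ℕ) (φ : Fml L) : Fml L
  | nu (p : ℕ) (φ : Fml L) : Fml L

namespace Fml

variable {L : OneStepLanguage.{u, v}}

/-- Free variables. -/
def FV : L.Fml → Set ℕ
  | var q => {q}
  | neg q => {q}
  | or φ ψ => φ.FV ∪ ψ.FV
  | and φ ψ => φ.FV ∪ ψ.FV
  | nxt _ φ => ⋃ i, (φ i).FV
  | mu p φ => φ.FV \ {p}
  | nu p φ => φ.FV \ {p}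

/-- The meaning of a formula in the frame `(T, R)` under a valuation `val`. -/
def sem {T : Type u} (R : T → T → Prop) : (ℕ → Set T) → L.Fml → Set T
  | val, var q => val q
  | val, neg q => (val q)ᶜ
  | val, or φ ψ => φ.sem R val ∪ ψ.sem R val
  | val, and φ ψ => φ.sem R val ∩ ψ.sem R val
  | val, nxt α φ => {s | L.Truth α {t // R s t} (fun i => {t | t.1 ∈ (φ i).sem R val})}
  | val, mu p φ => ⋂₀ {X | φ.sem R (Function.update val p X) ⊆ X}
  | val, nu p φ => ⋃₀ {X | X ⊆ φ.sem R (Function.update val p X)}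

/-- `S ⊩ φ`. -/
def Holds {P : Finset ℕ} (S : LTS.{u} P) (φ : L.Fml) : Prop :=
  S.init ∈ φ.sem S.R S.val

/-- `φ` is monotone in the proposition letter `p`. -/
def MonotoneIn (p : ℕ) (φ : L.Fml) : Prop :=
  ∀ (T : Type u) (R : T → T → Prop) (val : ℕ → Set T) (X Y : Set T), X ⊆ Y →
    φ.sem R (Function.update val p X) ⊆ φ.sem R (Function.update val p Y)

/-- The language `μL₁`. -/
inductive IsMu : L.Fml → Prop
  | var (q : ℕ) : IsMu (var q)
  | neg (q : ℕ) : IsMu (neg q)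
  | or {φ ψ : L.Fml} : IsMu φ → IsMu ψ → IsMu (or φ ψ)
  | and {φ ψ : L.Fml} : IsMu φ → IsMu ψ → IsMu (and φ ψ)
  | nxt {n : ℕ} {α : L.Form n} {φ : Fin n → L.Fml} :
      α ∈ L.pos n → (∀ i, IsMu (φ i)) → IsMu (nxt α φ)
  | mu {p : ℕ} {φ : L.Fml} : IsMu φ → φ.MonotoneIn p → IsMu (mu p φ)
  | nu {p : ℕ} {φ : L.Fml} : IsMu φ → φ.MonotoneIn p → IsMu (nu p φ)

/-- The fragment of `μL₁` that is noetherian in `Q`. -/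
inductive IsNoe : Set ℕ → L.Fml → Prop
  | var {Q : Set ℕ} {q : ℕ} : q ∈ Q → IsNoe Q (var q)
  | free {Q : Set ℕ} {ψ : L.Fml} : IsMu ψ → Disjoint ψ.FV Q → IsNoe Q ψ
  | or {Q : Set ℕ} {φ ψ : L.Fml} : IsNoe Q φ → IsNoe Q ψ → IsNoe Q (or φ ψ)
  | and {Q : Set ℕ} {φ ψ : L.Fml} : IsNoe Q φ → IsNoe Q ψ → IsNoe Q (and φ ψ)
  | nxt {Q : Set ℕ} {n : ℕ} {α : L.Form n} {φ : Fin n → L.Fml} :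
      α ∈ L.pos n → (∀ i, IsNoe Q (φ i)) → IsNoe Q (nxt α φ)
  | mu {Q : Set ℕ} {p : ℕ} {φ : L.Fml} : IsNoe (insert p Q) φ → IsNoe Q (mu p φ)

/-- The fragment of `μL₁` that is co-noetherian in `Q`. -/
inductive IsConoe : Set ℕ → L.Fml → Prop
  | var {Q : Set ℕ} {q : ℕ} : q ∈ Q → IsConoe Q (var q)
  | free {Q : Set ℕ} {ψ : L.Fml} : IsMu ψ → Disjoint ψ.FV Q → IsConoe Q ψ
  | or {Q : Set ℕ} {φ ψ : L.Fml} : IsConoe Q φ → IsConoe Q ψ → IsConoe Q (or φ ψ)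
  | and {Q : Set ℕ} {φ ψ : L.Fml} : IsConoe Q φ → IsConoe Q ψ → IsConoe Q (and φ ψ)
  | nxt {Q : Set ℕ} {n : ℕ} {α : L.Form n} {φ : Fin n → L.Fml} :
      α ∈ L.pos n → (∀ i, IsConoe Q (φ i)) → IsConoe Q (nxt α φ)
  | nu {Q : Set ℕ} {p : ℕ} {φ : L.Fml} : IsConoe (insert p Q) φ → IsConoe Q (nu p φ)

/-- The fragment of `μL₁` that is continuous in `Q`. In the modal clause, `B` is the set of
predicates of `α` in which `α` is continuous; the other arguments are `Q`-free. -/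
inductive IsCon : Set ℕ → L.Fml → Prop
  | var {Q : Set ℕ} {q : ℕ} : q ∈ Q → IsCon Q (var q)
  | free {Q : Set ℕ} {ψ : L.Fml} : IsMu ψ → Disjoint ψ.FV Q → IsCon Q ψ
  | or {Q : Set ℕ} {φ ψ : L.Fml} : IsCon Q φ → IsCon Q ψ → IsCon Q (or φ ψ)
  | and {Q : Set ℕ} {φ ψ : L.Fml} : IsCon Q φ → IsCon Q ψ → IsCon Q (and φ ψ)
  | nxt {Q : Set ℕ} {n : ℕ} {α : L.Form n} {φ : Fin n → L.Fml} (B : Set (Fin n)) :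
      α ∈ L.pos n → α ∈ L.con B → (∀ i ∈ B, IsCon Q (φ i)) →
      (∀ i, i ∉ B → IsMu (φ i) ∧ Disjoint (φ i).FV Q) → IsCon Q (nxt α φ)
  | mu {Q : Set ℕ} {p : ℕ} {φ : L.Fml} : IsCon (insert p Q) φ → IsCon Q (mu p φ)

/-- The fragment of `μL₁` that is co-continuous in `Q`. -/
inductive IsCocon : Set ℕ → L.Fml → Prop
  | var {Q : Set ℕ} {q : ℕ} : q ∈ Q → IsCocon Q (var q)
  | free {Q : Set ℕ} {ψ : L.Fml} : IsMu ψ → Disjoint ψ.FV Q → IsCocon Q ψ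
  | or {Q : Set ℕ} {φ ψ : L.Fml} : IsCocon Q φ → IsCocon Q ψ → IsCocon Q (or φ ψ)
  | and {Q : Set ℕ} {φ ψ : L.Fml} : IsCocon Q φ → IsCocon Q ψ → IsCocon Q (and φ ψ)
  | nxt {Q : Set ℕ} {n : ℕ} {α : L.Form n} {φ : Fin n → L.Fml} (B : Set (Fin n)) :
      α ∈ L.pos n → α ∈ L.cocon B → (∀ i ∈ B, IsCocon Q (φ i)) →
      (∀ i, i ∉ B → IsMu (φ i) ∧ Disjoint (φ i).FV Q) → IsCocon Q (nxt α φ)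
  | nu {Q : Set ℕ} {p : ℕ} {φ : L.Fml} : IsCocon (insert p Q) φ → IsCocon Q (nu p φ)

/-- The alternation-free `μ`-calculus `μ_D L₁`. -/
inductive IsMuD : L.Fml → Prop
  | var (q : ℕ) : IsMuD (var q)
  | neg (q : ℕ) : IsMuD (neg q)
  | or {φ ψ : L.Fml} : IsMuD φ → IsMuD ψ → IsMuD (or φ ψ)
  | and {φ ψ : L.Fml} : IsMuD φ → IsMuD ψ → IsMuD (and φ ψ)
  | nxt {n : ℕ} {α : L.Form n} {φ : Fin n → L.Fml} :
      α ∈ L.pos n → (∀ i, IsMuD (φ i)) → IsMuD (nxt α φ)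
  | mu {p : ℕ} {φ : L.Fml} : IsMuD φ → IsNoe {p} φ → IsMuD (mu p φ)
  | nu {p : ℕ} {φ : L.Fml} : IsMuD φ → IsConoe {p} φ → IsMuD (nu p φ)

/-- The continuous `μ`-calculus `μ_C L₁`. -/
inductive IsMuC : L.Fml → Prop
  | var (q : ℕ) : IsMuC (var q)
  | neg (q : ℕ) : IsMuC (neg q)
  | or {φ ψ : L.Fml} : IsMuC φ → IsMuC ψ → IsMuC (or φ ψ)
  | and {φ ψ : L.Fml} : IsMuC φ → IsMuC ψ → IsMuC (and φ ψ)
  | nxt {n : ℕ} {α : L.Form n} {φ : Fin n → L.Fml} :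
      α ∈ L.pos n → (∀ i, IsMuC (φ i)) → IsMuC (nxt α φ)
  | mu {p : ℕ} {φ : L.Fml} : IsMuC φ → IsCon {p} φ → IsMuC (mu p φ)
  | nu {p : ℕ} {φ : L.Fml} : IsMuC φ → IsCocon {p} φ → IsMuC (nu p φ)

end Fml

/-! ### Effectivity -/

/-- A Gödel numbering of the one-step formulas for which it is decidable which predicates occur in
a formula. -/
structure Coding (L : OneStepLanguage.{u, v}) where
  code : {n : ℕ} → L.Form n → ℕ
  code_injective : ∀ n : ℕ, Function.Injective (code : L.Form n → ℕ)
  occ_computable : ∃ g : ℕ × ℕ × ℕ → Bool, Computable g ∧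
    ∀ (n : ℕ) (α : L.Form n) (i : Fin n), g (n, code α, (i : ℕ)) = true ↔ i ∈ L.occ α

/-- A formula written in prefix notation, as a word over `ℕ`. -/
def Fml.word {L : OneStepLanguage.{u, v}} (e : L.Coding) : L.Fml → List ℕ
  | .var q => [0, q]
  | .neg q => [1, q]
  | .or φ ψ => 2 :: (φ.word e ++ ψ.word e)
  | .and φ ψ => 3 :: (φ.word e ++ ψ.word e)
  | .nxt (n := n) α φ => 4 :: n :: e.code α :: (List.ofFn fun i => (φ i).word e).flatten
  | .mu p φ => 5 :: p :: φ.word e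
  | .nu p φ => 6 :: p :: φ.word e

/-- All colours over `P`, listed in a fixed computable order. -/
def colours (P : Finset ℕ) : List P.powerset :=
  (P.sort (· ≤ ·)).sublists.attach.map fun l =>
    ⟨l.1.toFinset, Finset.mem_powerset.2 fun _ hx =>
      (Finset.mem_sort (· ≤ ·)).1
        ((List.mem_sublists.1 l.2).subset (List.mem_toFinset.1 hx))⟩

/-- The finite presentation of an automaton: its proposition letters, its transition table (one row
for each state, one entry for each colour), its priorities, and its initial state. -/
def Automaton.table {L : OneStepLanguage.{u, v}} (e : L.Coding) {P : Finset ℕ}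
    (A : L.Automaton P) : List ℕ × List (List ℕ) × List ℕ × ℕ :=
  (P.sort (· ≤ ·),
   List.ofFn fun a => (colours P).map fun c => e.code (A.Δ a c),
   List.ofFn A.Ω,
   (A.init : ℕ))

/-- A translation from automata to formulas is effective if some algorithm computes the output,
written as a word, from the finite presentation of the input. -/
def Effective {L : OneStepLanguage.{u, v}} (e : L.Coding)
    (ξ : (P : Finset ℕ) → L.Automaton P → L.Fml) : Prop :=
  ∃ f : List ℕ × List (List ℕ) × List ℕ × ℕ → List ℕ, Computable f ∧
    ∀ (P : Finset ℕ) (A : L.Automaton P), f (A.table e) = (ξ P A).word e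

end OneStepLanguage

/-!
The formula is obtained by unravelling the automaton into a finite tree with back edges. A node
carries a state `a` and the set `B` of states that are bound at this place. If `a ∈ B`, the node is
a leaf, the variable of `a`. Otherwise `a` becomes bound by a fixpoint operator, `ν` or `μ` as its
priority is even or odd, the states of lower priority are released, and the children of the node
are all states that occur in the transitions of `a` (`push`, `unravel`, `treeFml`). Since a state
outweighs all states of lower priority together (`weight_lt_weight_push`), the tree is finite.

Equivalence with the automaton is proved without positional determinacy. The meaning of the formula
is a nested fixpoint `solve` of the set operators given by the one-step formulas (`sem_treeFml`). If
a point lies in it, the player can maintain truth by keeping as memory the stack of bound states,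
each least fixpoint on the stack being annotated with an ordinal stage of its approximation
(`Stack.exists_step`). Returning to a bound state of a least fixpoint lowers its ordinal and
cuts the stack back to it, while states of lower priority leave this part of the stack alone.
Read lexicographically from the outermost state, the ordinals would descend forever if the maximal
recurring priority belonged to a least fixpoint (`Stack.not_pol_of_run`). This gives a winning
strategy of `∃` (`winningE_of_mem_solve`). As the statement is invariant under complementation
(`solve_compl`), the same memory lets `∀` beat any given strategy of `∃` from a point at which the
formula is false (`mem_solve_of_winningE`).

The fragments come from the free variables. Only states that can be reached are free in an
unravelling (`FV_treeFml`), so a subformula that has left a cluster contains no variable of this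
cluster. In a weak automaton all fixpoints over one cluster are of the same kind, and the body of
each of them is built from its variables by the clauses of the fragment (`ClusterFragment`).

For effectivity, the unravelling is repeated on words and finite presentations. It is a recursion on
the depth with varying arguments, hence primitive recursive (`primrec_treeWord`), once the
occurrences of states in the transitions are tabulated by the given decision procedure.
-/

/-! ### Unravelling a finite set of states with priorities -/

namespace Unravel

variable {n : ℕ}

/-- The states that are bound after passing through the unbound state `a`: states of lower priority
are released, and `a` becomes bound. -/
def push (Ω : Fin n → ℕ) (B : Finset (Fin n)) (a : Fin n) : Finset (Fin n) :=
  insert a (B.filter fun b => Ω a ≤ Ω b)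

/-- A measure that grows whenever an unbound state is pushed: one state outweighs all states of
lower priority together. -/
def weight (Ω : Fin n → ℕ) (B : Finset (Fin n)) : ℕ := ∑ b ∈ B, (n + 1) ^ Ω b

theorem weight_lt_weight_push (Ω : Fin n → ℕ) {B : Finset (Fin n)} {a : Fin n} (ha : a ∉ B) :
    weight Ω B < weight Ω (push Ω B a) := by
  have h1 : ∑ b ∈ B.filter (fun b => ¬ Ω a ≤ Ω b), (n + 1) ^ Ω b < (n + 1) ^ Ω a := by
    -- At most `n` summands, each of them at most an `(n + 1)`-th of the bound.
    have h : (n + 1) * ∑ b ∈ B.filter (fun b => ¬ Ω a ≤ Ω b), (n + 1) ^ Ω b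
        ≤ n * (n + 1) ^ Ω a := by
      rw [Finset.mul_sum]
      refine (Finset.sum_le_card_nsmul _ _ ((n + 1) ^ Ω a) fun b hb => ?_).trans ?_
      · rw [← pow_succ']
        exact Nat.pow_le_pow_right (by omega) (by simp at hb; omega)
      · rw [smul_eq_mul]
        exact Nat.mul_le_mul_right _ ((Finset.card_le_univ _).trans (by simp))
    have hpos : 0 < (n + 1) ^ Ω a := by positivity
    refine lt_of_not_ge fun hc => ?_
    nlinarith [Nat.mul_le_mul_left (n + 1) hc]
  rw [weight, weight, push, Finset.sum_insert (by simp [ha]),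
    ← Finset.sum_filter_add_sum_filter_not B fun b => Ω a ≤ Ω b]
  omega

theorem weight_le_univ (Ω : Fin n → ℕ) (B : Finset (Fin n)) :
    weight Ω B ≤ weight Ω Finset.univ :=
  Finset.sum_le_sum_of_subset (Finset.subset_univ B)

/-- The unravelling from the state `a` with bound states `B`: a bound state is a leaf, and an
unbound state is a node whose children are the unravellings from all states. -/
def unravel {β : Type*} (Ω : Fin n → ℕ) (leaf : Fin n → β) (node : Fin n → (Fin n → β) → β)
    (B : Finset (Fin n)) (a : Fin n) : β :=
  if a ∈ B then leaf a else node a fun b => unravel Ω leaf node (push Ω B a) b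
termination_by weight Ω Finset.univ - weight Ω B
decreasing_by
  rename_i h
  have := weight_lt_weight_push Ω h
  have := weight_le_univ Ω (push Ω B a)
  omega

/-- Induction along the unravelling: an unbound state may use the claim for all its children. -/
theorem push_induction (Ω : Fin n → ℕ) {p : Finset (Fin n) → Fin n → Prop}
    (step : ∀ B a, (a ∉ B → ∀ b, p (push Ω B a) b) → p B a) (B : Finset (Fin n)) (a : Fin n) :
    p B a := by
  refine step B a fun ha b => push_induction Ω step (push Ω B a) b
termination_by weight Ω Finset.univ - weight Ω B
decreasing_by
  have := weight_lt_weight_push Ω ha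
  have := weight_le_univ Ω (push Ω B a)
  omega

section
variable {β γ : Type*} {Ω : Fin n → ℕ} {leaf : Fin n → β} {node : Fin n → (Fin n → β) → β}
  {B : Finset (Fin n)} {a : Fin n}

theorem unravel_of_mem (h : a ∈ B) : unravel Ω leaf node B a = leaf a := by
  rw [unravel, if_pos h]

theorem unravel_of_notMem (h : a ∉ B) :
    unravel Ω leaf node B a = node a fun b => unravel Ω leaf node (push Ω B a) b := by
  rw [unravel, if_neg h]

/-- Maps that commute with leaves and nodes commute with the unravelling. -/
theorem map_unravel (h : β → γ) {leaf' : Fin n → γ} {node' : Fin n → (Fin n → γ) → γ}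
    (hl : ∀ a, h (leaf a) = leaf' a) (hn : ∀ a φ, h (node a φ) = node' a fun b => h (φ b))
    (B : Finset (Fin n)) (a : Fin n) :
    h (unravel Ω leaf node B a) = unravel Ω leaf' node' B a := by
  induction B, a using push_induction Ω with
  | step B a ih =>
    by_cases ha : a ∈ B
    · rw [unravel_of_mem ha, unravel_of_mem ha, hl]
    · rw [unravel_of_notMem ha, unravel_of_notMem ha, hn]
      exact congrArg _ (funext fun b => ih ha b)

end

/-! ### Nested fixpoints along the unravelling -/

/-- The least (if `l` holds) or greatest (otherwise) fixpoint of a monotone set operator. -/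
noncomputable def fixpoint {T : Type*} (l : Prop) (g : Set T → Set T) : Set T :=
  open Classical in if l then ⋂₀ {X | g X ⊆ X} else ⋃₀ {X | X ⊆ g X}

theorem fixpoint_mono {T : Type*} (l : Prop) {g g' : Set T → Set T} (h : ∀ X, g X ⊆ g' X) :
    fixpoint l g ⊆ fixpoint l g' := by
  unfold fixpoint
  split_ifs
  · exact sInter_subset_sInter fun X hX => (h X).trans hX
  · exact sUnion_subset_sUnion fun X hX => hX.trans (h X)

theorem fixpoint_compl {T : Type*} (l : Prop) (g : Set T → Set T) :
    fixpoint (¬ l) (fun X => (g Xᶜ)ᶜ) = (fixpoint l g)ᶜ := by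
  unfold fixpoint
  by_cases hl : l
  · simp only [hl, not_true_eq_false, if_true, if_false, sInter_eq_biInter, sUnion_eq_biUnion,
      compl_iInter]
    ext s
    simp only [mem_iUnion, mem_ofPred_eq, mem_compl_iff, exists_prop]
    constructor
    · rintro ⟨X, hX, hs⟩
      exact ⟨Xᶜ, subset_compl_comm.1 hX, not_not.2 hs⟩
    · rintro ⟨X, hX, hs⟩
      exact ⟨Xᶜ, by rw [compl_compl]; exact compl_subset_compl.2 hX, hs⟩
  · simp only [hl, not_false_eq_true, if_true, if_false, sInter_eq_biInter, sUnion_eq_biUnion,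
      compl_iUnion]
    ext s
    simp only [mem_iInter, mem_ofPred_eq, mem_compl_iff]
    constructor
    · intro h X hX
      exact h Xᶜ (by rw [compl_compl]; exact compl_subset_compl.2 hX)
    · intro h X hX
      by_contra hs
      exact h Xᶜ (compl_subset_comm.1 hX) hs

variable {T : Type u}

/-- The value of the unravelling from `a` with bound states `B`, where the state `a` is read as the
set operator `Θ a`, nodes are fixpoints (least ones at the priorities in `pol`), and bound states
are interpreted by `X`. -/
noncomputable def solve (Ω : Fin n → ℕ) (pol : ℕ → Prop) (Θ : Fin n → (Fin n → Set T) → Set T) :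
    Finset (Fin n) → Fin n → (Fin n → Set T) → Set T :=
  unravel Ω (fun a X => X a) fun a g X =>
    fixpoint (pol (Ω a)) fun Z => Θ a fun b => g b (Function.update X a Z)

section
variable {Ω : Fin n → ℕ} {pol : ℕ → Prop} {Θ : Fin n → (Fin n → Set T) → Set T}

theorem solve_of_mem {B : Finset (Fin n)} {a : Fin n} (h : a ∈ B) (X : Fin n → Set T) :
    solve Ω pol Θ B a X = X a := by
  rw [solve, unravel_of_mem h]

theorem solve_of_notMem {B : Finset (Fin n)} {a : Fin n} (h : a ∉ B) (X : Fin n → Set T) :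
    solve Ω pol Θ B a X = fixpoint (pol (Ω a)) fun Z =>
      Θ a fun b => solve Ω pol Θ (push Ω B a) b (Function.update X a Z) := by
  rw [solve, unravel_of_notMem h]

theorem solve_mono (hΘ : ∀ a, Monotone (Θ a)) (B : Finset (Fin n)) (a : Fin n) :
    Monotone (solve Ω pol Θ B a) := by
  induction B, a using push_induction Ω with
  | step B a ih =>
    intro X Y hXY
    by_cases ha : a ∈ B
    · rw [solve_of_mem ha, solve_of_mem ha]
      exact hXY a
    · rw [solve_of_notMem ha, solve_of_notMem ha]
      exact fixpoint_mono _ fun Z => hΘ a fun b => ih ha b (update_le_update_iff.2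
        ⟨le_rfl, fun c _ => hXY c⟩)

/-- Only the interpretation of the bound states matters. -/
theorem solve_congr (B : Finset (Fin n)) (a : Fin n) {X Y : Fin n → Set T}
    (h : ∀ b ∈ B, X b = Y b) : solve Ω pol Θ B a X = solve Ω pol Θ B a Y := by
  induction B, a using push_induction Ω generalizing X Y with
  | step B a ih =>
    by_cases ha : a ∈ B
    · rw [solve_of_mem ha, solve_of_mem ha, h a ha]
    · rw [solve_of_notMem ha, solve_of_notMem ha]
      congr! 4 with Z b
      refine ih ha b fun c hc => ?_
      rcases eq_or_ne c a with rfl | hca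
      · simp
      · simp only [push, Finset.mem_insert, hca, Finset.mem_filter, false_or] at hc
        simp [hca, h c hc.1]

/-- Complementing the interpretation, dualizing the operators and exchanging least and greatest
fixpoints complements the value of the unravelling. -/
theorem solve_compl (B : Finset (Fin n)) (a : Fin n) (X : Fin n → Set T) :
    solve Ω (fun k => ¬ pol k) (fun a Y => (Θ a fun b => (Y b)ᶜ)ᶜ) B a X
      = (solve Ω pol Θ B a fun b => (X b)ᶜ)ᶜ := by
  induction B, a using push_induction Ω generalizing X with
  | step B a ih =>
    by_cases ha : a ∈ B
    · rw [solve_of_mem ha, solve_of_mem ha, compl_compl]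
    · rw [solve_of_notMem ha, solve_of_notMem ha, ← fixpoint_compl]
      have h : ∀ Z, (fun b => (solve Ω (fun k => ¬ pol k) (fun a Y => (Θ a fun b => (Y b)ᶜ)ᶜ)
          (push Ω B a) b (Function.update X a Z))ᶜ) = fun b =>
          solve Ω pol Θ (push Ω B a) b (Function.update (fun b => (X b)ᶜ) a Zᶜ) := by
        intro Z
        funext b
        rw [ih ha, compl_compl]
        congr 1
        funext c
        rcases eq_or_ne c a with rfl | hca <;> simp [*]
      simp only [h]

end

/-! ### Annotated stacks and the descent of ordinals -/

/-- The fixpoint of `g`, cut off at stage `o` of its ordinal approximation if it is a least one. -/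
noncomputable def approx (l : Prop) (g : Set T →o Set T) (o : Ordinal.{u}) : Set T :=
  open Classical in if l then OrdinalApprox.lfpApprox g ⊥ o else g.gfp

theorem exists_approx_of_mem_fixpoint {l : Prop} {g : Set T →o Set T} {s : T}
    (hs : s ∈ fixpoint l g) : ∃ o, s ∈ g (approx l g o) := by
  by_cases hl : l
  · simp only [fixpoint, hl, if_true] at hs
    obtain ⟨o, ho⟩ := OrdinalApprox.lfp_mem_range_lfpApprox g
    refine ⟨o, ?_⟩
    simp only [approx, hl, if_true]
    rw [ho, g.map_lfp]
    exact hs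
  · simp only [fixpoint, hl, if_false] at hs
    refine ⟨0, ?_⟩
    simp only [approx, hl, if_false]
    rw [g.map_gfp]
    exact hs

/-- Membership in a stage of a least fixpoint is witnessed at an earlier stage. -/
theorem exists_lt_of_mem_approx {l : Prop} {g : Set T →o Set T} {o : Ordinal.{u}} {s : T}
    (hs : s ∈ approx l g o) : ∃ o', (l → o' < o) ∧ s ∈ g (approx l g o') := by
  by_cases hl : l
  · simp only [approx, hl, if_true] at hs ⊢
    rw [OrdinalApprox.lfpApprox] at hs
    simpa using hs
  · simp only [approx, hl, if_false] at hs ⊢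
    rw [g.map_gfp]
    exact ⟨o, by simp, hs⟩

/-- Stacks of bound states, the innermost first, each with the ordinal at which its fixpoint is
approximated. -/
abbrev Stack (n : ℕ) : Type (u + 1) := List (Fin n × Ordinal.{u})

/-- The bound states of a stack. -/
def Stack.keys (m : Stack.{u} n) : Finset (Fin n) := (m.map Prod.fst).toFinset

/-- A stack is valid if its states are distinct and their priorities do not decrease outwards. -/
def Stack.Valid (Ω : Fin n → ℕ) (m : Stack.{u} n) : Prop :=
  (m.map Prod.fst).Nodup ∧ m.Pairwise fun x y => Ω x.1 ≤ Ω y.1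

/-- The stacks that can follow `m` when the state `a` is visited. An unbound state is pushed after
the release of all states of lower priority. At a bound state the stack is cut back to that state,
and its ordinal has to drop if its fixpoint is a least one. -/
def Stack.Step (Ω : Fin n → ℕ) (pol : ℕ → Prop) (a : Fin n) (m m' : Stack.{u} n) : Prop :=
  (a ∉ m.map Prod.fst ∧ ∃ o, m' = (a, o) :: m.dropWhile fun x => Ω x.1 < Ω a) ∨
  ∃ pre r o o', m = pre ++ (a, o) :: r ∧ m' = (a, o') :: r ∧ (pol (Ω a) → o' < o)

theorem Stack.keys_cons (x : Fin n × Ordinal.{u}) (m : Stack.{u} n) :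
    Stack.keys (x :: m) = insert x.1 (Stack.keys m) := by
  simp [Stack.keys]

theorem Stack.mem_keys {m : Stack.{u} n} {a : Fin n} : a ∈ m.keys ↔ a ∈ m.map Prod.fst := by
  rw [Stack.keys, List.mem_toFinset]

theorem Stack.Valid.of_suffix {Ω : Fin n → ℕ} {m r : Stack.{u} n} (hm : m.Valid Ω)
    (h : r <:+ m) : Stack.Valid Ω r :=
  ⟨hm.1.sublist (h.sublist.map _), hm.2.sublist h.sublist⟩

theorem Stack.Valid.keys_dropWhile {Ω : Fin n → ℕ} {m : Stack.{u} n} (hm : m.Valid Ω) (k : ℕ) :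
    Stack.keys (m.dropWhile fun x => Ω x.1 < k) = m.keys.filter fun b => k ≤ Ω b := by
  induction m with
  | nil => rfl
  | cons x m ih =>
    have hm' : Stack.Valid Ω m := hm.of_suffix (List.suffix_cons x m)
    by_cases hx : Ω x.1 < k
    · rw [List.dropWhile_cons_of_pos (by simpa using hx), ih hm', Stack.keys_cons,
        Finset.filter_insert, if_neg (by omega)]
    · rw [List.dropWhile_cons_of_neg (by simpa using hx), eq_comm, Finset.filter_eq_self]
      intro b hb
      rw [Stack.keys_cons, Finset.mem_insert, Stack.mem_keys, List.mem_map] at hb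
      rcases hb with rfl | ⟨y, hy, rfl⟩
      · omega
      · have := List.rel_of_pairwise_cons hm.2 hy
        omega

section
variable {Ω : Fin n → ℕ} {pol : ℕ → Prop} {Θ : Fin n → (Fin n → Set T) → Set T}

/-- The operator whose fixpoint is taken at the state `a` when the states in `B` are bound to `X`
and none of them is released. -/
noncomputable def bodyOp (Ω : Fin n → ℕ) (pol : ℕ → Prop) (hΘ : ∀ a, Monotone (Θ a))
    (B : Finset (Fin n)) (a : Fin n) (X : Fin n → Set T) : Set T →o Set T where
  toFun Z := Θ a fun b => solve Ω pol Θ (insert a B) b (Function.update X a Z)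
  monotone' _ _ h := hΘ a fun b => solve_mono hΘ _ b (Function.update_mono h)

/-- The interpretation of the bound states that a stack stands for. -/
noncomputable def Stack.val (Ω : Fin n → ℕ) (pol : ℕ → Prop) (hΘ : ∀ a, Monotone (Θ a)) :
    Stack.{u} n → Fin n → Set T
  | [] => fun _ => ∅
  | (a, o) :: r => Function.update (Stack.val Ω pol hΘ r) a
      (approx (pol (Ω a)) (bodyOp Ω pol hΘ (Stack.keys r) a (Stack.val Ω pol hΘ r)) o)

theorem Stack.val_append {hΘ : ∀ a, Monotone (Θ a)} (pre r : Stack.{u} n) {b : Fin n}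
    (hb : b ∉ pre.map Prod.fst) :
    Stack.val Ω pol hΘ (pre ++ r) b = Stack.val Ω pol hΘ r b := by
  induction pre with
  | nil => rfl
  | cons x pre ih =>
    simp only [List.map_cons, List.mem_cons, not_or] at hb
    simp [Stack.val, Function.update_of_ne hb.1, ih hb.2]

/-- Truth of an unravelling persists along some step of the annotated stack. -/
theorem Stack.exists_step (hΘ : ∀ a, Monotone (Θ a)) {m : Stack.{u} n} (hm : m.Valid Ω)
    {a : Fin n} {s : T} (hs : s ∈ solve Ω pol Θ m.keys a (m.val Ω pol hΘ)) :
    ∃ m' : Stack.{u} n, m.Step Ω pol a m' ∧ m'.Valid Ω ∧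
      s ∈ Θ a fun b => solve Ω pol Θ m'.keys b (m'.val Ω pol hΘ) := by
  by_cases ha : a ∈ m.map Prod.fst
  · rw [solve_of_mem (Stack.mem_keys.2 ha)] at hs
    obtain ⟨⟨a', o⟩, hx, rfl⟩ := List.mem_map.1 ha
    obtain ⟨pre, r, rfl⟩ := List.append_of_mem hx
    have hpre : a' ∉ pre.map Prod.fst := by
      have := hm.1
      rw [List.map_append, List.nodup_append] at this
      intro h
      exact this.2.2 _ h _ (by simp) rfl
    rw [Stack.val_append _ _ hpre, Stack.val, Function.update_self] at hs
    obtain ⟨o', ho, hs'⟩ := exists_lt_of_mem_approx hs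
    have hv : Stack.Valid Ω ((a', o) :: r) := hm.of_suffix (List.suffix_append _ _)
    refine ⟨(a', o') :: r, .inr ⟨pre, r, o, o', rfl, rfl, ho⟩, ⟨by simpa using hv.1, ?_⟩, ?_⟩
    · have := hv.2
      rw [List.pairwise_cons] at this ⊢
      exact this
    · rw [Stack.keys_cons]
      exact hs'
  · rw [solve_of_notMem (mt Stack.mem_keys.1 ha)] at hs
    set r : Stack.{u} n := m.dropWhile fun x => Ω x.1 < Ω a with hr
    have hsuf : r <:+ m := List.dropWhile_suffix _
    have hrv : Stack.Valid Ω r := hm.of_suffix hsuf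
    have hkeys : Stack.keys r = m.keys.filter fun b => Ω a ≤ Ω b := hm.keys_dropWhile _
    -- Released states no longer matter, so the stack may be replaced by its remaining part `r`.
    have hs2 : s ∈ fixpoint (pol (Ω a)) (bodyOp Ω pol hΘ (Stack.keys r) a (r.val Ω pol hΘ)) := by
      refine fixpoint_mono _ (fun Z => ?_) hs
      refine (hΘ a fun b => ?_)
      rw [push, ← hkeys]
      refine (solve_congr _ _ fun c hc => ?_).le
      rcases eq_or_ne c a with rfl | hca
      · simp
      · have hc' : c ∈ r.map Prod.fst := by
          simpa [hca, Stack.mem_keys] using hc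
        obtain ⟨pre, hpre⟩ := hsuf
        simp only [Function.update_of_ne hca]
        rw [← hpre]
        refine Stack.val_append _ _ fun h => ?_
        have := hm.1
        rw [← hpre, List.map_append, List.nodup_append] at this
        exact this.2.2 _ h _ hc' rfl
    obtain ⟨o, ho⟩ := exists_approx_of_mem_fixpoint hs2
    refine ⟨(a, o) :: r, .inl ⟨ha, o, rfl⟩, ⟨?_, ?_⟩, ?_⟩
    · rw [List.map_cons, List.nodup_cons]
      exact ⟨fun h => ha ((hsuf.sublist.map _).subset h), hrv.1⟩
    · refine List.pairwise_cons.2 ⟨fun y hy => ?_, hrv.2⟩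
      have : y.1 ∈ Stack.keys r := Stack.mem_keys.2 (List.mem_map_of_mem hy)
      rw [hkeys] at this
      exact (Finset.mem_filter.1 this).2
    · rw [Stack.keys_cons]
      exact ho

end

/-- The ordinals of a stack, the outermost first, padded with `⊤`. -/
noncomputable def Stack.signature (m : Stack.{u} n) : Lex (Fin n → WithTop Ordinal.{u}) :=
  toLex fun i => (m.reverse[(i : ℕ)]?).elim ⊤ fun x => (x.2 : WithTop Ordinal.{u})

theorem Stack.signature_push_lt {m : Stack.{u} n} (hm : m.length < n) (x : Fin n × Ordinal.{u}) :
    Stack.signature (x :: m) < Stack.signature m := by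
  refine ⟨⟨m.length, hm⟩, fun j hj => ?_, ?_⟩
  · have hj' : (j : ℕ) < m.length := hj
    simp [Stack.signature, List.getElem?_append_left, hj']
  · simp [Stack.signature]

/-- Cutting a stack back and lowering the ordinal at the top decreases the signature, whatever is cut
off. -/
theorem Stack.signature_cut_lt {pre r : Stack.{u} n} {a : Fin n} {o o' : Ordinal.{u}}
    (hr : r.length < n) (ho : o' < o) :
    Stack.signature ((a, o') :: r) < Stack.signature (pre ++ (a, o) :: r) := by
  refine ⟨⟨r.length, hr⟩, fun j hj => ?_, ?_⟩
  · have hj' : (j : ℕ) < r.length := hj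
    simp [Stack.signature, List.getElem?_append_left, hj']
  · simp [Stack.signature, ho]

theorem Stack.Valid.length_le {Ω : Fin n → ℕ} {m : Stack.{u} n} (hm : m.Valid Ω) :
    m.length ≤ n := by
  simpa using hm.1.length_le_card

theorem dropWhile_dropWhile_of_imp {α : Type*} {p q : α → Bool} (h : ∀ x, q x → p x)
    (l : List α) : (l.dropWhile q).dropWhile p = l.dropWhile p := by
  induction l with
  | nil => rfl
  | cons x l ih =>
    by_cases hq : q x
    · rw [List.dropWhile_cons_of_pos hq, List.dropWhile_cons_of_pos (h x hq), ih]
    · rw [List.dropWhile_cons_of_neg hq]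

/-- The part of the stack with priorities at least `k` does not change when a state of priority
below `k` is visited. -/
theorem Stack.Step.dropWhile_eq {Ω : Fin n → ℕ} {pol : ℕ → Prop} {a : Fin n} {m m' : Stack.{u} n}
    (hm : m.Valid Ω) (h : m.Step Ω pol a m') {k : ℕ} (hk : Ω a < k) :
    (m'.dropWhile fun x => Ω x.1 < k) = m.dropWhile fun x => Ω x.1 < k := by
  rcases h with ⟨-, o, rfl⟩ | ⟨pre, r, o, o', rfl, rfl, -⟩
  · rw [List.dropWhile_cons_of_pos (by simpa using hk)]
    refine dropWhile_dropWhile_of_imp (fun x hx => ?_) _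
    simp only [decide_eq_true_eq] at hx ⊢
    omega
  · have hpre : ∀ x ∈ pre, Ω x.1 < k := fun x hx =>
      ((List.pairwise_append.1 hm.2).2.2 x hx _ List.mem_cons_self).trans_lt hk
    rw [List.dropWhile_append_of_pos (by simpa using hpre),
      List.dropWhile_cons_of_pos (by simpa using hk),
      List.dropWhile_cons_of_pos (by simpa using hk)]

/-- The part of the stack with priorities at least `k` descends when a state of priority `k` is
visited, if the fixpoints of priority `k` are least ones. -/
theorem Stack.Step.signature_lt {Ω : Fin n → ℕ} {pol : ℕ → Prop} {a : Fin n} {m m' : Stack.{u} n}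
    (hm : m.Valid Ω) (hm' : m'.Valid Ω) (h : m.Step Ω pol a m') (ha : pol (Ω a)) :
    Stack.signature (m'.dropWhile fun x => Ω x.1 < Ω a) <
      Stack.signature (m.dropWhile fun x => Ω x.1 < Ω a) := by
  have hlen := hm'.length_le
  rcases h with ⟨-, o, rfl⟩ | ⟨pre, r, o, o', rfl, rfl, ho⟩
  · rw [List.dropWhile_cons_of_neg (by simp)]
    exact Stack.signature_push_lt (by simpa using hlen) _
  · rw [List.dropWhile_cons_of_neg (by simp), List.dropWhile_append]
    have hr : r.length < n := by simpa using hlen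
    split_ifs
    · rw [List.dropWhile_cons_of_neg (by simp)]
      exact Stack.signature_cut_lt (pre := []) hr (ho ha)
    · exact Stack.signature_cut_lt hr (ho ha)

/-- Along an infinite run of annotated stacks, a maximal recurring priority does not belong to a
least fixpoint. -/
theorem Stack.not_pol_of_run {Ω : Fin n → ℕ} {pol : ℕ → Prop} {m : ℕ → Stack.{u} n}
    {a : ℕ → Fin n} (hm : ∀ i, (m i).Valid Ω) (hs : ∀ i, (m i).Step Ω pol (a i) (m (i + 1)))
    {k : ℕ} (hk : ∃ᶠ i in atTop, Ω (a i) = k) (hle : ∀ᶠ i in atTop, Ω (a i) ≤ k) :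
    ¬ pol k := by
  intro hpol
  obtain ⟨N, hN⟩ := eventually_atTop.1 hle
  set σ : ℕ → Lex (Fin n → WithTop Ordinal.{u}) := fun i =>
    Stack.signature ((m (N + i)).dropWhile fun x => Ω x.1 < k) with hσ
  have hlt : ∀ i, Ω (a (N + i)) = k → σ (i + 1) < σ i := by
    rintro i rfl
    exact (hs (N + i)).signature_lt (hm _) (hm _) hpol
  have hanti : Antitone σ := antitone_nat_of_succ_le fun i => by
    rcases (hN (N + i) (by omega)).lt_or_eq with h | h
    · exact (congrArg Stack.signature ((hs (N + i)).dropWhile_eq (hm _) h)).le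
    · exact (hlt i h).le
  obtain ⟨i, hi⟩ := WellFounded.has_min (wellFounded_lt (α := Lex (Fin n → WithTop Ordinal.{u})))
    (range σ) ⟨_, 0, rfl⟩
  obtain ⟨⟨i, rfl⟩, hmin⟩ := hi
  obtain ⟨j, hj, hjk⟩ := frequently_atTop.1 hk (N + i)
  obtain ⟨d, rfl⟩ := Nat.exists_eq_add_of_le hj
  rw [add_assoc] at hjk
  exact hmin _ ⟨_, rfl⟩ ((hlt _ hjk).trans_le (hanti (by omega)))

/-- Truth of an unravelling yields a memory structure that maintains it: from every position in the
invariant `Inv` the operator `Θ` keeps the invariant for the updated memory, and along infinite runs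
the maximal recurring priority does not belong to a least fixpoint. -/
theorem exists_memory (Ω : Fin n → ℕ) (pol : ℕ → Prop) {Θ : Fin n → (Fin n → Set T) → Set T}
    (hΘ : ∀ a, Monotone (Θ a)) :
    ∃ (M : Type (u + 1)) (m₀ : M) (Inv : M → Fin n → T → Prop) (next : M → Fin n → T → M),
      (∀ a s, s ∈ solve Ω pol Θ ∅ a (fun _ => ∅) → Inv m₀ a s) ∧
      (∀ m a s, Inv m a s → s ∈ Θ a fun b => {t | Inv (next m a s) b t}) ∧
      ∀ (m : ℕ → M) (a : ℕ → Fin n) (s : ℕ → T), (∀ i, Inv (m i) (a i) (s i)) →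
        (∀ i, m (i + 1) = next (m i) (a i) (s i)) →
        ∀ k, (∃ᶠ i in atTop, Ω (a i) = k) → (∀ᶠ i in atTop, Ω (a i) ≤ k) → ¬ pol k := by
  have key : ∀ (m : Stack.{u} n) (a : Fin n) (s : T), ∃ m' : Stack.{u} n, m.Valid Ω →
      s ∈ solve Ω pol Θ m.keys a (m.val Ω pol hΘ) → m.Step Ω pol a m' ∧ m'.Valid Ω ∧
      s ∈ Θ a fun b => solve Ω pol Θ m'.keys b (m'.val Ω pol hΘ) := by
    intro m a s
    by_cases h : m.Valid Ω ∧ s ∈ solve Ω pol Θ m.keys a (m.val Ω pol hΘ)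
    · obtain ⟨m', hm'⟩ := Stack.exists_step hΘ h.1 h.2
      exact ⟨m', fun _ _ => hm'⟩
    · exact ⟨m, fun h1 h2 => absurd ⟨h1, h2⟩ h⟩
  choose next hnext using key
  refine ⟨Stack.{u} n, [],
    fun m a s => m.Valid Ω ∧ s ∈ solve Ω pol Θ m.keys a (m.val Ω pol hΘ), next, ?_, ?_, ?_⟩
  · intro a s hs
    have h : Stack.Valid Ω ([] : Stack.{u} n) := ⟨List.nodup_nil, List.Pairwise.nil⟩
    exact ⟨h, hs⟩
  · rintro m a s ⟨hv, hs⟩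
    obtain ⟨-, hv', hs'⟩ := hnext m a s hv hs
    refine hΘ a (fun b => ?_) hs'
    exact fun t ht => And.intro hv' ht
  · intro m a s hInv hm k hk hle
    refine Stack.not_pol_of_run (fun i => (hInv i).1) (fun i => ?_) hk hle
    rw [hm i]
    exact (hnext _ _ _ (hInv i).1 (hInv i).2).1

end Unravel

/-! ### Plays of parity games -/

namespace ParityGame

variable {G : Type*}

theorem history_succ (w : ℕ → G) (k : ℕ) : history w (k + 1) = history w k ++ [w (k + 1)] := by
  simp [history, List.range_succ]

theorem getLast?_history (w : ℕ → G) (k : ℕ) : (history w k).getLast? = some (w k) := by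
  simp [history, List.range_succ]

/-- A rule that extends every finite sequence of positions generates an infinite one. -/
theorem exists_play (φ : List G → G) (x : G) :
    ∃ w : ℕ → G, w 0 = x ∧ ∀ k, w (k + 1) = φ (history w k) := by
  let H : ℕ → List G := fun k => Nat.rec [x] (fun _ h => h ++ [φ h]) k
  let w : ℕ → G := fun k => Nat.casesOn k x fun k => φ (H k)
  have hH : ∀ k, history w k = H k := by
    intro k
    induction k with
    | zero => rfl
    | succ k ih => rw [history_succ, ih]
  exact ⟨w, rfl, fun k => by rw [hH]⟩

theorem Guided.of_succ {𝒢 : ParityGame G} {f : List G → G} {w : ℕ → G} {k : ℕ}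
    (h : 𝒢.Guided f w (k + 1)) : 𝒢.Guided f w k := fun i hi => h i (by omega)

theorem parityWin_iff {𝒢 : ParityGame G} {w : ℕ → G} {k : ℕ}
    (hk : ∃ᶠ i in atTop, 𝒢.prio (w i) = k) (hle : ∀ᶠ i in atTop, 𝒢.prio (w i) ≤ k) :
    𝒢.ParityWin w ↔ Even k := by
  -- The upper bound `k` recurs, so it is the only candidate for the maximal recurring priority.
  have hmax : ∀ m, (∃ᶠ i in atTop, 𝒢.prio (w i) = m) → m ≤ k := by
    intro m hm
    obtain ⟨i, hi, hi'⟩ := (hm.and_eventually hle).exists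
    exact hi ▸ hi'
  constructor
  · rintro ⟨m, hm, hfreq, hm'⟩
    rwa [le_antisymm (hm' k hk) (hmax m hfreq)]
  · exact fun h => ⟨k, h, hk, hmax⟩

end ParityGame

theorem exists_max_recurring {α : Type*} [Finite α] (Ω : α → ℕ) (a : ℕ → α) :
    ∃ k, (∃ᶠ i in atTop, Ω (a i) = k) ∧ ∀ᶠ i in atTop, Ω (a i) ≤ k := by
  obtain ⟨K, hK⟩ := (Set.finite_range Ω).bddAbove
  have hbdd : ∀ᶠ i in atTop, Ω (a i) ≤ K := Eventually.of_forall fun i => hK ⟨a i, rfl⟩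
  classical
  have hex : ∃ K, ∀ᶠ i in atTop, Ω (a i) ≤ K := ⟨K, hbdd⟩
  refine ⟨Nat.find hex, fun hne => ?_, Nat.find_spec hex⟩
  have hlt : ∀ᶠ i in atTop, Ω (a i) < Nat.find hex :=
    (Nat.find_spec hex).mp (hne.mono fun i hi hle => lt_of_le_of_ne hle hi)
  rcases Nat.eq_zero_or_pos (Nat.find hex) with h0 | h0
  · obtain ⟨i, hi⟩ := hlt.exists
    omega
  · exact Nat.find_min hex (Nat.sub_lt h0 one_pos) (hlt.mono fun i hi => by omega)

namespace OneStepLanguage.Automaton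

open ParityGame Unravel

variable {L : OneStepLanguage.{u, v}} {P : Finset ℕ}

/-! ### The acceptance game -/

/-- The set operator of the state `a` on the frame `(T, R)` with colouring `κ`: the points at which
the one-step formula of `a` holds when the states are interpreted by `Y`. -/
def oneStep (A : L.Automaton P) {T : Type u} (R : T → T → Prop) (κ : T → P.powerset)
    (a : Fin A.n) (Y : Fin A.n → Set T) : Set T :=
  {s | L.Truth (A.Δ a (κ s)) {t // R s t} fun b => {t | t.1 ∈ Y b}}

theorem oneStep_mono (A : L.Automaton P) {T : Type u} (R : T → T → Prop) (κ : T → P.powerset)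
    (a : Fin A.n) : Monotone (A.oneStep R κ a) := fun _ _ h s hs =>
  L.pos_monotone _ (A.Δ_pos a (κ s)) _ _ _
    ⟨fun b _ _ ht => h b ht, fun b hb => absurd (mem_univ b) hb⟩ hs

section
variable (A : L.Automaton P) (S : LTS.{u} P)

/-- The positions of the acceptance game. -/
abbrev Pos : Type u := (Fin A.n × S.T) ⊕ (Fin A.n → Set S.T)

/-- The update of a memory when a position is visited: valuations are ignored. -/
def updMem {M : Type*} (next : M → Fin A.n → S.T → M) (m : M) :
    A.Pos S → M
  | .inl (a, s) => next m a s
  | .inr _ => m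

/-- The memory after a sequence of positions. -/
def memory {M : Type*} (next : M → Fin A.n → S.T → M) (m₀ : M)
    (h : List (A.Pos S)) : M :=
  h.foldl (A.updMem S next) m₀

variable {A S}

theorem memory_range_succ {M : Type*} (next : M → Fin A.n → S.T → M) (m₀ : M)
    (w : ℕ → A.Pos S) (k : ℕ) :
    A.memory S next m₀ ((List.range (k + 1)).map w) =
      A.updMem S next (A.memory S next m₀ ((List.range k).map w)) (w k) := by
  simp [memory, List.range_succ]

theorem exists_inr_of_move {x y : A.Pos S}
    (h : (A.acceptanceGame S).move x y) (hx : x.isLeft = true) : ∃ V, y = .inr V := by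
  rcases x with ⟨a, s⟩ | V <;> rcases y with ⟨b, t⟩ | V'
  · exact h.elim
  · exact ⟨V', rfl⟩
  · simp at hx
  · simp at hx

theorem exists_inl_of_move {V : Fin A.n → Set S.T}
    {y : A.Pos S} (h : (A.acceptanceGame S).move (.inr V) y) :
    ∃ b t, y = .inl (b, t) ∧ t ∈ V b := by
  rcases y with ⟨b, t⟩ | V'
  · exact ⟨b, t, rfl, h⟩
  · exact h.elim

/-- An infinite match alternates between the two kinds of positions, and its winner is determined
by the states that it visits. -/
theorem exists_states {w : ℕ → A.Pos S}
    (h0 : (w 0).isLeft = true) (hw : ∀ k, (A.acceptanceGame S).move (w k) (w (k + 1))) :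
    ∃ (a : ℕ → Fin A.n) (s : ℕ → S.T), (∀ i, w (2 * i) = .inl (a i, s i)) ∧
      (∀ i, ∃ V, w (2 * i + 1) = .inr V) ∧
      ∃ k, (∃ᶠ i in atTop, A.Ω (a i) = k) ∧ (∀ᶠ i in atTop, A.Ω (a i) ≤ k) ∧
        ((A.acceptanceGame S).ParityWin w ↔ Even k) := by
  have hl : ∀ i, ∃ p : Fin A.n × S.T, w (2 * i) = .inl p := by
    intro i
    induction i with
    | zero => exact Sum.isLeft_iff.1 h0
    | succ i ih =>
      obtain ⟨p, hp⟩ := ih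
      obtain ⟨V, hV⟩ := exists_inr_of_move (hw (2 * i)) (by simp [hp])
      have := hw (2 * i + 1)
      rw [hV] at this
      obtain ⟨b, t, hbt, -⟩ := exists_inl_of_move this
      exact ⟨(b, t), hbt⟩
  choose p hp using hl
  have hr : ∀ i, ∃ V, w (2 * i + 1) = .inr V := fun i =>
    exists_inr_of_move (hw (2 * i)) (by simp [hp])
  obtain ⟨k, hk, hle⟩ := exists_max_recurring A.Ω fun i => (p i).1
  refine ⟨fun i => (p i).1, fun i => (p i).2, hp, hr, k, hk, hle, parityWin_iff ?_ ?_⟩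
  · rw [frequently_atTop] at hk ⊢
    intro N
    obtain ⟨i, hi, hik⟩ := hk N
    exact ⟨2 * i, by omega, by rw [hp]; exact hik⟩
  · rw [eventually_atTop] at hle ⊢
    obtain ⟨N, hN⟩ := hle
    refine ⟨2 * N, fun j hj => ?_⟩
    rcases Nat.even_or_odd' j with ⟨i, rfl | rfl⟩
    · rw [hp]
      exact hN i (by omega)
    · obtain ⟨V, hV⟩ := hr i
      rw [hV]
      exact Nat.zero_le k

/-- Truth gives a strategy for `∃`: choose the valuation that consists of all positions at which the
invariant holds for the current memory. -/
theorem winningE_of_mem_solve {a : Fin A.n} {s : S.T}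
    (h : s ∈ solve A.Ω (fun k => ¬ Even k) (A.oneStep S.R S.κ) ∅ a fun _ => ∅) :
    (A.acceptanceGame S).WinningE (.inl (a, s)) := by
  obtain ⟨M, m₀, Inv, next, h0, hstep, hrun⟩ :=
    exists_memory A.Ω (fun k => ¬ Even k) (A.oneStep_mono S.R S.κ)
  let f : List (A.Pos S) → A.Pos S := fun h =>
    match h.getLast? with
    | some (.inl (_, s)) => .inr fun b => {t | S.R s t ∧ Inv (A.memory S next m₀ h) b t}
    | _ => .inl (a, s)
  refine ⟨f, fun w hw0 => ?_⟩
  let μ : ℕ → M := fun k => A.memory S next m₀ ((List.range k).map w)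
  have hμ : ∀ k, μ (k + 1) = A.updMem S next (μ k) (w k) := memory_range_succ next m₀ w
  have hf : ∀ k a s, w k = .inl (a, s) →
      f (history w k) = .inr fun b => {t | S.R s t ∧ Inv (μ (k + 1)) b t} := by
    intro k a s hk
    simp only [f, getLast?_history, hk]
    rfl
  -- The invariant holds at every state position, and at every pair that `∀` can choose.
  have hJ : ∀ k, (A.acceptanceGame S).Guided f w k →
      (∀ a s, w k = .inl (a, s) → Inv (μ k) a s) ∧
      ∀ V, w k = .inr V → ∀ b, ∀ t ∈ V b, Inv (μ k) b t := by
    intro k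
    induction k with
    | zero =>
      intro _
      refine ⟨fun a' s' h' => ?_, fun V hV => ?_⟩
      · rw [hw0, Sum.inl.injEq, Prod.mk.injEq] at h'
        exact h'.1 ▸ h'.2 ▸ h0 a s h
      · rw [hw0] at hV
        cases hV
    | succ k ih =>
      intro hg
      obtain ⟨ih1, ih2⟩ := ih hg.of_succ
      obtain ⟨hmove, hguide⟩ := hg k (by omega)
      rcases hk : w k with ⟨a', s'⟩ | V
      · rw [hguide (by simp [hk, acceptanceGame]), hf k a' s' hk]
        refine ⟨fun _ _ h' => (by cases h'), ?_⟩
        rintro V ⟨⟩ b t ht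
        exact ht.2
      · rw [hk] at hmove
        obtain ⟨b, t, hbt, ht⟩ := exists_inl_of_move hmove
        rw [hbt]
        refine ⟨?_, fun _ h' => (by cases h')⟩
        rintro _ _ ⟨⟩
        rw [hμ, hk]
        exact ih2 V hk b t ht
  refine ⟨fun k hg hE => ?_, fun hg => ?_⟩
  · obtain ⟨⟨a', s'⟩, hk⟩ := Sum.isLeft_iff.1 hE
    rw [hf k a' s' hk, hk]
    refine ⟨fun b t ht => ht.1, ?_⟩
    have := hstep _ _ _ ((hJ k (hg)).1 a' s' hk)
    have hμk : μ (k + 1) = next (μ k) a' s' := by rw [hμ, hk]; rfl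
    rw [← hμk] at this
    refine L.pos_monotone _ (A.Δ_pos a' (S.κ s')) _ _ _
      ⟨fun b _ t ht => ⟨t.2, ht⟩, fun b hb => absurd (mem_univ b) hb⟩ this
  · obtain ⟨a', s', hl, hr, k, hk, hle, hwin⟩ := exists_states (by simp [hw0])
      fun k => (hg (k + 1) k (by omega)).1
    rw [hwin]
    refine not_not.1 (hrun (fun i => μ (2 * i)) a' s' (fun i => (hJ _ (hg _)).1 _ _ (hl i))
      (fun i => ?_) k hk hle)
    obtain ⟨V, hV⟩ := hr i
    change μ (2 * i + 1 + 1) = _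
    rw [hμ, hV, hμ, hl]
    rfl

/-- Falsity lets `∀` beat every strategy of `∃`: reply with a position at which the invariant for
the dual operators holds. -/
theorem mem_solve_of_winningE {a : Fin A.n} {s : S.T}
    (h : (A.acceptanceGame S).WinningE (.inl (a, s))) :
    s ∈ solve A.Ω (fun k => ¬ Even k) (A.oneStep S.R S.κ) ∅ a fun _ => ∅ := by
  by_contra hs
  obtain ⟨f, hf⟩ := h
  have hs' : s ∈ solve A.Ω (fun k => ¬ ¬ Even k)
      (fun a Y => (A.oneStep S.R S.κ a fun b => (Y b)ᶜ)ᶜ) ∅ a fun _ => ∅ := by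
    rw [solve_compl (pol := fun k => ¬ Even k)]
    rwa [solve_congr ∅ a (Y := fun _ => ∅) (by simp)]
  obtain ⟨M, m₀, Inv, next, h0, hstep, hrun⟩ := exists_memory A.Ω (fun k => ¬ ¬ Even k)
    (Θ := fun a Y => (A.oneStep S.R S.κ a fun b => (Y b)ᶜ)ᶜ)
    fun a Y Z hYZ => compl_subset_compl.2
      (A.oneStep_mono S.R S.κ a fun b => compl_subset_compl.2 (hYZ b))
  classical
  let φ : List (A.Pos S) → A.Pos S := fun h =>
    match h.getLast? with
    | some (.inr V) =>
        if hp : ∃ p : Fin A.n × S.T, p.2 ∈ V p.1 ∧ Inv (A.memory S next m₀ h) p.1 p.2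
        then .inl hp.choose else .inl (a, s)
    | _ => f h
  obtain ⟨w, hw0, hw⟩ := exists_play φ (.inl (a, s))
  let μ : ℕ → M := fun k => A.memory S next m₀ ((List.range k).map w)
  have hμ : ∀ k, μ (k + 1) = A.updMem S next (μ k) (w k) := memory_range_succ next m₀ w
  obtain ⟨hlegal, hwin⟩ := hf w hw0
  -- The match follows `f`, and at a valuation `∀` has a reply that keeps the dual invariant.
  have hJ : ∀ k, (A.acceptanceGame S).Guided f w k ∧
      (∀ a s, w k = .inl (a, s) → Inv (μ k) a s) ∧
      ∀ V, w k = .inr V → ∃ p : Fin A.n × S.T, p.2 ∈ V p.1 ∧ Inv (μ k) p.1 p.2 := by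
    intro k
    induction k with
    | zero =>
      refine ⟨fun i hi => absurd hi (Nat.not_lt_zero i), fun a' s' h' => ?_, fun V hV => ?_⟩
      · rw [hw0, Sum.inl.injEq, Prod.mk.injEq] at h'
        exact h'.1 ▸ h'.2 ▸ h0 a s hs'
      · rw [hw0] at hV
        cases hV
    | succ k ih =>
      obtain ⟨hg, ih1, ih2⟩ := ih
      have hgs : (A.acceptanceGame S).move (w k) (w (k + 1)) →
          ((w k).isLeft = true → w (k + 1) = f (history w k)) →
          (A.acceptanceGame S).Guided f w (k + 1) := by
        intro h1 h2 i hi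
        rcases Nat.lt_succ_iff_lt_or_eq.1 hi with hi | rfl
        · exact hg i hi
        · exact ⟨h1, h2⟩
      rcases hk : w k with ⟨a', s'⟩ | V
      · have hwk : w (k + 1) = f (history w k) := by
          rw [hw]
          simp only [φ, getLast?_history, hk]
        have hmove := hlegal k hg (by simp [hk, acceptanceGame])
        rw [← hwk] at hmove
        refine ⟨hgs hmove fun _ => hwk, ?_⟩
        obtain ⟨V, hV⟩ := exists_inr_of_move hmove (by simp [hk])
        rw [hk, hV] at hmove
        rw [hV]
        refine ⟨fun _ _ h' => (by cases h'), ?_⟩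
        rintro V' hV'
        obtain rfl := Sum.inr.inj hV'
        -- Without such a reply, the valuation would refute the dual invariant by monotonicity.
        by_contra! hno
        refine hstep _ _ _ (ih1 a' s' hk) ?_
        have hμk : μ (k + 1) = next (μ k) a' s' := by rw [hμ, hk]; rfl
        refine A.oneStep_mono S.R S.κ a' (fun b t ht => ?_) hmove.2
        rw [← hμk]
        exact hno (b, t) ht
      · have hp := ih2 V hk
        have hp' : ∃ p : Fin A.n × S.T,
            p.2 ∈ V p.1 ∧ Inv (A.memory S next m₀ (history w k)) p.1 p.2 := by
          have hμk : A.memory S next m₀ (history w k) = μ k := by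
            change μ (k + 1) = _
            rw [hμ, hk]
            rfl
          rwa [hμk]
        have hwk : w (k + 1) = .inl hp'.choose := by
          rw [hw]
          simp only [φ, getLast?_history, hk]
          rw [dif_pos hp']
        have hspec := hp'.choose_spec
        rw [hwk]
        refine ⟨hgs ?_ (by simp [hk]), ?_, fun _ h' => (by cases h')⟩
        · rw [hk, hwk]
          exact hspec.1
        · intro b t hbt
          rw [Sum.inl.injEq] at hbt
          rw [hbt] at hspec
          exact hspec.2
  have hg := fun k => (hJ k).1
  obtain ⟨a', s', hl, hr, k, hk, hle, hwin'⟩ := exists_states (by simp [hw0])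
    fun k => (hg (k + 1) k (by omega)).1
  refine hrun (fun i => μ (2 * i)) a' s' (fun i => (hJ _).2.1 _ _ (hl i))
    (fun i => ?_) k hk hle (not_not.2 (hwin'.1 (hwin hg)))
  obtain ⟨V, hV⟩ := hr i
  change μ (2 * i + 1 + 1) = _
  rw [hμ, hV, hμ, hl]
  rfl

theorem accepts_iff :
    A.Accepts S ↔
      S.init ∈ solve A.Ω (fun k => ¬ Even k) (A.oneStep S.R S.κ) ∅ A.init fun _ => ∅ :=
  ⟨mem_solve_of_winningE, winningE_of_mem_solve⟩

end

end OneStepLanguage.Automaton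

namespace OneStepLanguage

open Unravel

variable {L : OneStepLanguage.{u, v}} {P : Finset ℕ}

/-! ### The formula of an automaton -/

namespace Fml

/-- A closed formula that is false everywhere. -/
def bot : L.Fml := mu 0 (var 0)

/-- A closed formula that is true everywhere. -/
def top : L.Fml := nu 0 (var 0)

theorem FV_bot : (bot : L.Fml).FV = ∅ := by simp [bot, FV]

theorem FV_top : (top : L.Fml).FV = ∅ := by simp [top, FV]

theorem sem_bot {T : Type u} (R : T → T → Prop) (val : ℕ → Set T) :
    (bot : L.Fml).sem R val = ∅ := by
  simp only [bot, sem, Function.update_self]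
  exact subset_empty_iff.1 (sInter_subset_of_mem (by simp))

theorem sem_top {T : Type u} (R : T → T → Prop) (val : ℕ → Set T) :
    (top : L.Fml).sem R val = univ := by
  simp only [top, sem, Function.update_self]
  exact univ_subset_iff.1 (subset_sUnion_of_mem (t := univ) (by simp))

theorem monotoneIn_var (p : ℕ) : (var p : L.Fml).MonotoneIn p := by
  intro T R val X Y h
  simpa [sem] using h

theorem isMu_bot : (bot : L.Fml).IsMu := .mu (.var 0) (monotoneIn_var 0)

theorem isMu_top : (top : L.Fml).IsMu := .nu (.var 0) (monotoneIn_var 0)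

theorem isMuD_bot : (bot : L.Fml).IsMuD := .mu (.var 0) (.var rfl)

theorem isMuD_top : (top : L.Fml).IsMuD := .nu (.var 0) (.var rfl)

theorem isMuC_bot : (bot : L.Fml).IsMuC := .mu (.var 0) (.var rfl)

theorem isMuC_top : (top : L.Fml).IsMuC := .nu (.var 0) (.var rfl)

end Fml

/-- A number above all letters in `P`. -/
def offset (P : Finset ℕ) : ℕ := (P.sort (· ≤ ·)).sum + 1

/-- The variable of the state `a`, chosen outside `P`. -/
def stateVar (P : Finset ℕ) {n : ℕ} (a : Fin n) : ℕ := offset P + a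

theorem lt_offset {p : ℕ} (hp : p ∈ P) : p < offset P :=
  Nat.lt_succ_of_le (List.le_sum_of_mem ((Finset.mem_sort _).2 hp))

theorem stateVar_notMem {n : ℕ} (a : Fin n) : stateVar P a ∉ P := fun h => by
  have := lt_offset h
  rw [stateVar] at this
  omega

theorem stateVar_injective {n : ℕ} : Function.Injective (stateVar P : Fin n → ℕ) :=
  fun _ _ h => Fin.ext (Nat.add_left_cancel h)

theorem mem_colours (c : P.powerset) : c ∈ colours P := by
  refine List.mem_map.2 ⟨⟨(P.sort (· ≤ ·)).filter (· ∈ c.1), ?_⟩, List.mem_attach _ _, ?_⟩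
  · exact List.mem_sublists.2 List.filter_sublist
  · apply Subtype.ext
    ext p
    have := Finset.mem_powerset.1 c.2
    simp only [List.mem_toFinset, List.mem_filter, Finset.mem_sort, decide_eq_true_eq]
    exact ⟨fun h => h.2, fun h => ⟨this h, h⟩⟩

/-- The formula that says that the colour of a point is `c`. -/
def colourFml (L : OneStepLanguage.{u, v}) (P : Finset ℕ) (c : P.powerset) : L.Fml :=
  (P.sort (· ≤ ·)).foldr (fun p φ => .and (if p ∈ c.1 then .var p else .neg p) φ) .top

theorem colourFml_mem {C : L.Fml → Prop} (htop : C .top) (hvar : ∀ q, C (.var q))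
    (hneg : ∀ q, C (.neg q)) (hand : ∀ {φ ψ}, C φ → C ψ → C (.and φ ψ)) (c : P.powerset) :
    C (colourFml L P c) := by
  rw [colourFml]
  induction P.sort (· ≤ ·) with
  | nil => exact htop
  | cons p l ih => exact hand (by split_ifs <;> [exact hvar p; exact hneg p]) ih

theorem FV_colourFml (c : P.powerset) : (colourFml L P c).FV ⊆ P := by
  have h : ∀ l : List ℕ, (l.foldr (fun p φ =>
      Fml.and (if p ∈ c.1 then .var p else .neg p) φ) (.top : L.Fml)).FV ⊆ {p | p ∈ l} := by
    intro l
    induction l with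
    | nil => simp [Fml.FV_top]
    | cons p l ih =>
      simp only [List.foldr_cons, Fml.FV]
      refine union_subset ?_ (ih.trans fun q hq => List.mem_cons_of_mem p hq)
      split_ifs <;> simp [Fml.FV]
  refine (h _).trans fun p hp => ?_
  exact (Finset.mem_sort _).1 hp

/-- The colouring that is determined by a valuation. -/
noncomputable def colouring (P : Finset ℕ) {T : Type u} (val : ℕ → Set T) (s : T) : P.powerset :=
  open Classical in ⟨P.filter fun p => s ∈ val p, Finset.mem_powerset.2 (Finset.filter_subset _ _)⟩

theorem mem_colouring {T : Type u} {val : ℕ → Set T} {s : T} {p : ℕ} :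
    p ∈ (colouring P val s).1 ↔ p ∈ P ∧ s ∈ val p := by
  simp [colouring]

theorem colouring_val (S : LTS.{u} P) (s : S.T) : colouring P S.val s = S.κ s := by
  apply Subtype.ext
  ext p
  rw [mem_colouring]
  exact ⟨fun h => h.2, fun h => ⟨Finset.mem_powerset.1 (S.κ s).2 h, h⟩⟩

theorem mem_sem_colourFml {T : Type u} {R : T → T → Prop} {val : ℕ → Set T} {s : T}
    {c : P.powerset} : s ∈ (colourFml L P c).sem R val ↔ colouring P val s = c := by
  have h : ∀ l : List ℕ, s ∈ (l.foldr (fun p φ =>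
      Fml.and (if p ∈ c.1 then .var p else .neg p) φ) (.top : L.Fml)).sem R val ↔
      ∀ p ∈ l, (s ∈ val p ↔ p ∈ c.1) := by
    intro l
    induction l with
    | nil => simp [Fml.sem_top]
    | cons p l ih =>
      simp only [List.foldr_cons, Fml.sem, mem_inter_iff, ih, List.forall_mem_cons]
      refine and_congr_left fun _ => ?_
      split_ifs with hp <;> simp [Fml.sem, hp]
  rw [colourFml, h]
  simp only [Finset.mem_sort]
  constructor
  · intro h
    apply Subtype.ext
    ext p
    rw [mem_colouring]
    exact ⟨fun hp => (h p hp.1).1 hp.2, fun hp =>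
      have := Finset.mem_powerset.1 c.2 hp
      ⟨this, (h p this).2 hp⟩⟩
  · rintro rfl p hp
    rw [mem_colouring]
    simp [hp]

/-- The valuation that agrees with `X` on the variables of the states and with `val` elsewhere. -/
def bindVal (P : Finset ℕ) {n : ℕ} {T : Type u} (val : ℕ → Set T) (X : Fin n → Set T) (q : ℕ) :
    Set T :=
  if h : offset P ≤ q ∧ q - offset P < n then X ⟨q - offset P, h.2⟩ else val q

section
variable {n : ℕ} {T : Type u} (val : ℕ → Set T) (X : Fin n → Set T)

theorem bindVal_stateVar (a : Fin n) : bindVal P val X (stateVar P a) = X a := by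
  simp [bindVal, stateVar]

theorem colouring_bindVal : colouring P (bindVal P val X) = colouring P val := by
  funext s
  apply Subtype.ext
  ext p
  rw [mem_colouring, mem_colouring]
  refine and_congr_right fun hp => ?_
  have := lt_offset hp
  rw [bindVal, dif_neg (by omega)]

theorem update_bindVal (a : Fin n) (Z : Set T) :
    Function.update (bindVal P val X) (stateVar P a) Z = bindVal P val (Function.update X a Z) := by
  funext q
  rcases eq_or_ne q (stateVar P a) with rfl | hq
  · rw [Function.update_self, bindVal_stateVar, Function.update_self]
  · rw [Function.update_of_ne hq, bindVal, bindVal]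
    split_ifs with h
    · rw [Function.update_of_ne]
      rintro rfl
      apply hq
      simp only [stateVar]
      omega
    · rfl

theorem bindVal_self : bindVal P val (fun a : Fin n => val (stateVar P a)) = val := by
  funext q
  rw [bindVal]
  split_ifs with h
  · simp only [stateVar]
    rw [Nat.add_sub_cancel' h.1]
  · rfl

end

namespace Automaton

variable (A : L.Automaton P)

/-- The children of the modality for the state `a` and the colour `c`; predicates that do not occur
in the one-step formula get a closed formula. -/
noncomputable def trim (a : Fin A.n) (c : P.powerset) (φ : Fin A.n → L.Fml) (b : Fin A.n) : L.Fml :=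
  open Classical in if b ∈ L.occ (A.Δ a c) then φ b else .bot

/-- The transition of the state `a` as a formula, where the states are replaced by `φ`: a
disjunction over all colours. -/
noncomputable def stepFml (a : Fin A.n) (φ : Fin A.n → L.Fml) : L.Fml :=
  (colours P).foldr
    (fun c ψ => .or (.and (colourFml L P c) (.nxt (A.Δ a c) (A.trim a c φ))) ψ) .bot

/-- The fixpoint formula that binds the variable of the state `a`. -/
def fixFml (a : Fin A.n) (ψ : L.Fml) : L.Fml :=
  if Even (A.Ω a) then .nu (stateVar P a) ψ else .mu (stateVar P a) ψ

/-- The formula of the state `a` when the states in `B` are bound. -/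
noncomputable def treeFml : Finset (Fin A.n) → Fin A.n → L.Fml :=
  unravel A.Ω (fun a => .var (stateVar P a)) fun a φ => A.fixFml a (A.stepFml a φ)

variable {A}

theorem treeFml_of_mem {B : Finset (Fin A.n)} {a : Fin A.n} (h : a ∈ B) :
    A.treeFml B a = .var (stateVar P a) := unravel_of_mem h

theorem treeFml_of_notMem {B : Finset (Fin A.n)} {a : Fin A.n} (h : a ∉ B) :
    A.treeFml B a = A.fixFml a (A.stepFml a (A.treeFml (push A.Ω B a))) := unravel_of_notMem h

/-- The closure conditions under which the transition of a state lies in a class of formulas. -/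
theorem stepFml_mem {C : L.Fml → Prop} (hbot : C .bot)
    (hor : ∀ {φ ψ}, C φ → C ψ → C (.or φ ψ)) (hand : ∀ {φ ψ}, C φ → C ψ → C (.and φ ψ))
    (hcol : ∀ c, C (colourFml L P c)) {a : Fin A.n} {φ : Fin A.n → L.Fml}
    (hnxt : ∀ c, C (.nxt (A.Δ a c) (A.trim a c φ))) : C (A.stepFml a φ) := by
  rw [stepFml]
  induction colours P with
  | nil => exact hbot
  | cons c l ih => exact hor (hand (hcol c) (hnxt c)) ih

/-! ### Semantics of the formula -/

theorem sem_stepFml {T : Type u} (R : T → T → Prop) (val : ℕ → Set T) (a : Fin A.n)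
    (φ : Fin A.n → L.Fml) :
    (A.stepFml a φ).sem R val =
      A.oneStep R (colouring P val) a fun b => (φ b).sem R val := by
  ext s
  have hnxt : ∀ c, s ∈ (Fml.nxt (A.Δ a c) (A.trim a c φ)).sem R val ↔
      L.Truth (A.Δ a c) {t // R s t} fun b => {t | t.1 ∈ (φ b).sem R val} := by
    intro c
    refine L.truth_congr _ _ _ _ fun b hb => ?_
    simp [trim, hb]
  have h : ∀ l : List P.powerset, s ∈ (l.foldr (fun c ψ =>
      Fml.or (.and (colourFml L P c) (.nxt (A.Δ a c) (A.trim a c φ))) ψ) .bot).sem R val ↔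
      ∃ c ∈ l, colouring P val s = c ∧
        L.Truth (A.Δ a c) {t // R s t} fun b => {t | t.1 ∈ (φ b).sem R val} := by
    intro l
    induction l with
    | nil => simp [Fml.sem_bot]
    | cons c l ih =>
      rw [List.foldr_cons, Fml.sem, Fml.sem, mem_union, mem_inter_iff, hnxt, mem_sem_colourFml, ih]
      simp only [List.mem_cons, exists_eq_or_imp]
  rw [stepFml, h]
  constructor
  · rintro ⟨c, -, rfl, hc⟩
    exact hc
  · exact fun hs => ⟨_, mem_colours _, rfl, hs⟩

theorem sem_treeFml {T : Type u} (R : T → T → Prop) (val : ℕ → Set T) (B : Finset (Fin A.n))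
    (a : Fin A.n) (X : Fin A.n → Set T) :
    (A.treeFml B a).sem R (bindVal P val X) =
      solve A.Ω (fun k => ¬ Even k) (A.oneStep R (colouring P val)) B a X := by
  refine congrFun (map_unravel (fun (φ : L.Fml) (X : Fin A.n → Set T) => φ.sem R (bindVal P val X))
    (fun a => ?_) (fun a φ => ?_) B a) X
  · funext X
    exact bindVal_stateVar val X a
  · funext X
    have h : ∀ Z, (A.stepFml a φ).sem R (bindVal P val (Function.update X a Z)) =
        A.oneStep R (colouring P val) a fun b =>
          (φ b).sem R (bindVal P val (Function.update X a Z)) := fun Z => by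
      rw [sem_stepFml, colouring_bindVal]
    by_cases hp : Even (A.Ω a) <;>
      simp only [fixFml, fixpoint, hp, not_true_eq_false, not_false_eq_true, if_true, if_false,
        Fml.sem, update_bindVal, h]

theorem holds_treeFml_iff (S : LTS.{u} P) :
    (A.treeFml ∅ A.init).Holds S ↔ A.Accepts S := by
  have hκ : colouring P S.val = S.κ := funext (colouring_val S)
  rw [Fml.Holds, accepts_iff, ← bindVal_self (P := P) (n := A.n) S.val, sem_treeFml, hκ,
    solve_congr ∅ A.init (Y := fun _ => ∅) (by simp)]

theorem monotoneIn_stepFml (B : Finset (Fin A.n)) (a : Fin A.n) :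
    (A.stepFml a (A.treeFml B)).MonotoneIn (stateVar P a) := by
  intro T R val X Y h
  rw [← bindVal_self (P := P) (n := A.n) val, update_bindVal, update_bindVal, sem_stepFml,
    sem_stepFml, colouring_bindVal, colouring_bindVal]
  refine oneStep_mono A _ _ _ fun b => ?_
  rw [sem_treeFml, sem_treeFml]
  exact solve_mono (oneStep_mono A _ _) _ _ (Function.update_mono h)

/-! ### Syntactic fragments -/

theorem isMu_colourFml (c : P.powerset) : (colourFml L P c).IsMu :=
  colourFml_mem Fml.isMu_top .var .neg .and c

theorem isMu_treeFml (B : Finset (Fin A.n)) (a : Fin A.n) : (A.treeFml B a).IsMu := by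
  induction B, a using push_induction A.Ω with
  | step B a ih =>
    by_cases ha : a ∈ B
    · rw [treeFml_of_mem ha]
      exact .var _
    · have h : (A.stepFml a (A.treeFml (push A.Ω B a))).IsMu := by
        refine stepFml_mem Fml.isMu_bot .or .and isMu_colourFml fun c =>
          .nxt (A.Δ_pos a c) fun b => ?_
        rw [trim]
        split_ifs
        exacts [ih ha b, Fml.isMu_bot]
      rw [treeFml_of_notMem ha, fixFml]
      split_ifs
      exacts [.nu h (monotoneIn_stepFml _ _), .mu h (monotoneIn_stepFml _ _)]

/-- The free variables of an unravelling are letters of `P` and variables of bound states that can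
be reached. -/
theorem FV_treeFml (B : Finset (Fin A.n)) (a : Fin A.n) :
    (A.treeFml B a).FV ⊆ P ∪ stateVar P '' {b | b ∈ B ∧ (b = a ∨ A.Prec a b)} := by
  induction B, a using push_induction A.Ω with
  | step B a ih =>
    by_cases ha : a ∈ B
    · rw [treeFml_of_mem ha, Fml.FV, singleton_subset_iff]
      exact .inr ⟨a, ⟨ha, .inl rfl⟩, rfl⟩
    · have h : (A.stepFml a (A.treeFml (push A.Ω B a))).FV ⊆
          P ∪ stateVar P '' {b | b ∈ push A.Ω B a ∧ A.Prec a b} := by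
        refine stepFml_mem (C := fun φ => φ.FV ⊆ P ∪ stateVar P '' _) (by simp [Fml.FV_bot])
          union_subset union_subset
          (fun c => (FV_colourFml c).trans subset_union_left) fun c => ?_
        refine iUnion_subset fun b => ?_
        rw [trim]
        split_ifs with hb
        · refine (ih ha b).trans (union_subset_union_right _ (image_mono ?_))
          rintro d ⟨hd, hbd⟩
          have hab : A.Prec a b := .single ⟨c, hb⟩
          exact ⟨hd, hbd.elim (fun h => h ▸ hab) hab.trans⟩
        · simp [Fml.FV_bot]
      have hfix : (A.treeFml B a).FV =
          (A.stepFml a (A.treeFml (push A.Ω B a))).FV \ {stateVar P a} := by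
        rw [treeFml_of_notMem ha, fixFml]
        split_ifs <;> rfl
      rw [hfix]
      rintro q ⟨hq, hqa⟩
      rcases h hq with hq | ⟨b, ⟨hb, hab⟩, rfl⟩
      · exact .inl hq
      · have hba : b ≠ a := fun h => hqa (by rw [h]; rfl)
        simp only [push, Finset.mem_insert, hba, Finset.mem_filter, false_or] at hb
        exact .inr ⟨b, ⟨hb.1, .inr hab⟩, rfl⟩

theorem disjoint_stateVar {s : Set ℕ} (hs : s ⊆ P) (Q : Set (Fin A.n)) :
    Disjoint s (stateVar P '' Q) := by
  rw [disjoint_left]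
  rintro _ hq ⟨a, -, rfl⟩
  exact stateVar_notMem a (hs hq)

/-- Below a cluster, the variables of that cluster are no longer free. -/
theorem disjoint_FV_treeFml {r a : Fin A.n} (ha : A.Prec r a) (har : a ∉ A.cluster r)
    {Q : Set (Fin A.n)} (hQ : Q ⊆ A.cluster r) (B : Finset (Fin A.n)) :
    Disjoint (A.treeFml B a).FV (stateVar P '' Q) := by
  rw [disjoint_left]
  rintro _ hq ⟨b, hb, rfl⟩
  rcases FV_treeFml B a hq with hq | ⟨b', ⟨-, hb'⟩, hbb⟩
  · exact stateVar_notMem b hq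
  · obtain rfl := stateVar_injective hbb
    rcases hb' with rfl | hab
    · exact har (hQ hb)
    · rcases hQ hb with rfl | ⟨-, hbr⟩
      · exact har (.inr ⟨ha, hab⟩)
      · exact har (.inr ⟨ha, hab.trans hbr⟩)

theorem cluster_eq {r a : Fin A.n} (h : a ∈ A.cluster r) : A.cluster a = A.cluster r := by
  rcases h with rfl | ⟨hra, har⟩
  · rfl
  · ext b
    constructor
    · rintro (rfl | ⟨hab, hba⟩)
      exacts [.inr ⟨hra, har⟩, .inr ⟨hra.trans hab, hba.trans har⟩]
    · rintro (rfl | ⟨hrb, hbr⟩)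
      exacts [.inr ⟨har, hra⟩, .inr ⟨har.trans hrb, hbr.trans hra⟩]

/-- The closure conditions that put the unravellings from the cluster of `r` into a family `K` of
fragments, such as the formulas that are noetherian, or continuous, in a set of letters. -/
structure ClusterFragment (r : Fin A.n) (K : Set ℕ → L.Fml → Prop) : Prop where
  var : ∀ {Q q}, q ∈ Q → K Q (.var q)
  free : ∀ {Q ψ}, ψ.IsMu → Disjoint ψ.FV Q → K Q ψ
  or : ∀ {Q φ ψ}, K Q φ → K Q ψ → K Q (.or φ ψ)
  and : ∀ {Q φ ψ}, K Q φ → K Q ψ → K Q (.and φ ψ)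
  nxt : ∀ {Q a c φ}, a ∈ A.cluster r → (∀ b ∈ A.cluster r, K Q (φ b)) →
    (∀ b, b ∉ A.cluster r → (φ b).IsMu ∧ Disjoint (φ b).FV Q) → K Q (.nxt (A.Δ a c) φ)
  fix : ∀ {Q a ψ}, a ∈ A.cluster r → K (insert (stateVar P a) Q) ψ → K Q (A.fixFml a ψ)

namespace ClusterFragment

variable {r : Fin A.n} {K : Set ℕ → L.Fml → Prop}

theorem stepFml_mem (hK : ClusterFragment r K) {a : Fin A.n} (ha : a ∈ A.cluster r)
    {Q : Set (Fin A.n)} (hQ : Q ⊆ A.cluster r) {B : Finset (Fin A.n)}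
    (h : ∀ b ∈ A.cluster r, K (stateVar P '' Q) (A.treeFml B b)) :
    K (stateVar P '' Q) (A.stepFml a (A.treeFml B)) := by
  have hbot : Disjoint (Fml.bot : L.Fml).FV (stateVar P '' Q) := by simp [Fml.FV_bot]
  refine Automaton.stepFml_mem (hK.free Fml.isMu_bot hbot) hK.or hK.and
    (fun c => hK.free (isMu_colourFml c) (disjoint_stateVar (FV_colourFml c) Q))
    fun c => hK.nxt ha (fun b hb => ?_) fun b hb => ?_
  · rw [trim]
    split_ifs
    exacts [h b hb, hK.free Fml.isMu_bot hbot]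
  · rw [trim]
    split_ifs with hocc
    · refine ⟨isMu_treeFml _ _, disjoint_FV_treeFml (r := r) ?_ hb hQ _⟩
      have hab : A.Prec a b := .single ⟨c, hocc⟩
      rcases ha with rfl | ⟨hra, -⟩
      exacts [hab, hra.trans hab]
    · exact ⟨Fml.isMu_bot, hbot⟩

/-- Every bound state keeps its kind of fixpoint inside a cluster, so the variables in `Q` may grow
along the unravelling. -/
theorem treeFml_mem (hK : ClusterFragment r K) (B : Finset (Fin A.n)) {a : Fin A.n}
    (ha : a ∈ A.cluster r) {Q : Set (Fin A.n)} (hQ : Q ⊆ A.cluster r) :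
    K (stateVar P '' Q) (A.treeFml B a) := by
  induction B, a using push_induction A.Ω generalizing Q with
  | step B a ih =>
    by_cases haB : a ∈ B
    · rw [treeFml_of_mem haB]
      by_cases haQ : a ∈ Q
      · exact hK.var (mem_image_of_mem _ haQ)
      · refine hK.free (.var _) (disjoint_singleton_left.2 ?_)
        rwa [stateVar_injective.mem_set_image]
    · rw [treeFml_of_notMem haB]
      refine hK.fix ha ?_
      rw [← image_insert_eq]
      have hQ' : insert a Q ⊆ A.cluster r := insert_subset ha hQ
      exact hK.stepFml_mem ha hQ' fun b hb => ih haB b hb hQ'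

theorem body_mem (hK : ClusterFragment r K) (B : Finset (Fin A.n)) :
    K {stateVar P r} (A.stepFml r (A.treeFml B)) := by
  have hr : r ∈ A.cluster r := .inl rfl
  have := hK.stepFml_mem hr (singleton_subset_iff.2 hr) fun b hb =>
    hK.treeFml_mem B hb (singleton_subset_iff.2 hr)
  rwa [image_singleton] at this

end ClusterFragment

theorem clusterFragment_isNoe (hA : A.IsWeak) {r : Fin A.n} (hr : ¬ Even (A.Ω r)) :
    ClusterFragment r Fml.IsNoe where
  var := .var
  free := .free
  or := .or
  and := .and
  nxt {_ a c _} _ h1 h2 := .nxt (A.Δ_pos a c) fun b => by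
    by_cases hb : b ∈ A.cluster r
    exacts [h1 b hb, .free (h2 b hb).1 (h2 b hb).2]
  fix {_ a _} ha h := by
    rw [fixFml, if_neg (hA r a ha ▸ hr)]
    exact .mu h

theorem clusterFragment_isConoe (hA : A.IsWeak) {r : Fin A.n} (hr : Even (A.Ω r)) :
    ClusterFragment r Fml.IsConoe where
  var := .var
  free := .free
  or := .or
  and := .and
  nxt {_ a c _} _ h1 h2 := .nxt (A.Δ_pos a c) fun b => by
    by_cases hb : b ∈ A.cluster r
    exacts [h1 b hb, .free (h2 b hb).1 (h2 b hb).2]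
  fix {_ a _} ha h := by
    rw [fixFml, if_pos (hA r a ha ▸ hr)]
    exact .nu h

theorem clusterFragment_isCon (hA : A.IsWeakContinuous) {r : Fin A.n} (hr : ¬ Even (A.Ω r)) :
    ClusterFragment r Fml.IsCon where
  var := .var
  free := .free
  or := .or
  and := .and
  nxt {_ a c _} ha h1 h2 := by
    refine .nxt (A.cluster r) (A.Δ_pos a c) ?_ h1 h2
    rw [← cluster_eq ha]
    refine (hA.2.2 a c).1 ?_
    rw [hA.1 r a ha] at hr
    have := hA.2.1 a
    interval_cases h : A.Ω a
    · exact absurd Even.zero hr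
    · rfl
  fix {_ a _} ha h := by
    rw [fixFml, if_neg (hA.1 r a ha ▸ hr)]
    exact .mu h

theorem clusterFragment_isCocon (hA : A.IsWeakContinuous) {r : Fin A.n} (hr : Even (A.Ω r)) :
    ClusterFragment r Fml.IsCocon where
  var := .var
  free := .free
  or := .or
  and := .and
  nxt {_ a c _} ha h1 h2 := by
    refine .nxt (A.cluster r) (A.Δ_pos a c) ?_ h1 h2
    rw [← cluster_eq ha]
    refine (hA.2.2 a c).2 ?_
    rw [hA.1 r a ha] at hr
    have := hA.2.1 a
    interval_cases h : A.Ω a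
    · rfl
    · exact absurd hr Nat.not_even_one
  fix {_ a _} ha h := by
    rw [fixFml, if_pos (hA.1 r a ha ▸ hr)]
    exact .nu h

theorem isMuD_treeFml (hA : A.IsWeak) (B : Finset (Fin A.n)) (a : Fin A.n) :
    (A.treeFml B a).IsMuD := by
  induction B, a using push_induction A.Ω with
  | step B a ih =>
    by_cases ha : a ∈ B
    · rw [treeFml_of_mem ha]
      exact .var _
    · have h : (A.stepFml a (A.treeFml (push A.Ω B a))).IsMuD := by
        refine stepFml_mem Fml.isMuD_bot .or .and
          (colourFml_mem Fml.isMuD_top .var .neg .and) fun c => .nxt (A.Δ_pos a c) fun b => ?_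
        rw [trim]
        split_ifs
        exacts [ih ha b, Fml.isMuD_bot]
      rw [treeFml_of_notMem ha, fixFml]
      split_ifs with hp
      exacts [.nu h ((clusterFragment_isConoe hA hp).body_mem _),
        .mu h ((clusterFragment_isNoe hA hp).body_mem _)]

theorem isMuC_treeFml (hA : A.IsWeakContinuous) (B : Finset (Fin A.n)) (a : Fin A.n) :
    (A.treeFml B a).IsMuC := by
  induction B, a using push_induction A.Ω with
  | step B a ih =>
    by_cases ha : a ∈ B
    · rw [treeFml_of_mem ha]
      exact .var _
    · have h : (A.stepFml a (A.treeFml (push A.Ω B a))).IsMuC := by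
        refine stepFml_mem Fml.isMuC_bot .or .and
          (colourFml_mem Fml.isMuC_top .var .neg .and) fun c => .nxt (A.Δ_pos a c) fun b => ?_
        rw [trim]
        split_ifs
        exacts [ih ha b, Fml.isMuC_bot]
      rw [treeFml_of_notMem ha, fixFml]
      split_ifs with hp
      exacts [.nu h ((clusterFragment_isCocon hA hp).body_mem _),
        .mu h ((clusterFragment_isCon hA hp).body_mem _)]

end Automaton

end OneStepLanguage

namespace OneStepLanguage

open Unravel

/-! ### The translation on finite presentations -/

namespace Presentation

/-- The finite presentations of automata: letters, transition table, priorities, initial state. -/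
abbrev Table : Type := List ℕ × List (List ℕ) × List ℕ × ℕ

/-- A presentation together with the list of truth values of "the state `b` occurs in the entry for
the state `a` and the colour `c`", ordered lexicographically in `(a, c, b)`. -/
abbrev Data : Type := Table × List Bool

/-- The number of states. -/
def states (t : Table) : ℕ := t.2.2.1.length

/-- The sets of letters that are the colours. -/
def colourLists (t : Table) : List (List ℕ) := t.1.sublists

/-- The code of the one-step formula for the state `a` and the colour with index `c`. -/
def entry (t : Table) (a c : ℕ) : ℕ := (t.2.1.getD a []).getD c 0

/-- The priority of the state `a`. -/
def priority (t : Table) (a : ℕ) : ℕ := t.2.2.1.getD a 0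

/-- The variable of the state `a`. -/
def stateLetter (t : Table) (a : ℕ) : ℕ := t.1.foldr (fun p k => p + k) 0 + 1 + a

/-- The truth value of "`b` occurs in the entry for `a` and `c`". -/
def occurs (d : Data) (a c b : ℕ) : Bool :=
  d.2.getD ((a * (colourLists d.1).length + c) * states d.1 + b) false

/-- The word of the formula for the colour `s`. -/
def colourWord (l s : List ℕ) : List ℕ :=
  l.foldr (fun p w => 3 :: (if p ∈ s then 0 else 1) :: p :: w) [6, 0, 0, 0]

/-- The word of the modality for the state `a` and the colour `c`, given the words of the states. -/
def modalWord (d : Data) (ws : List (List ℕ)) (a c : ℕ) : List ℕ :=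
  4 :: states d.1 :: entry d.1 a c :: (List.range (states d.1)).flatMap fun b =>
    if occurs d a c b = true then ws.getD b [] else [5, 0, 0, 0]

/-- The word of the transition of the state `a`, given the words of the states. -/
def stepWord (d : Data) (ws : List (List ℕ)) (a : ℕ) : List ℕ :=
  (List.range (colourLists d.1).length).foldr (fun c w =>
    2 :: 3 :: (colourWord d.1.1 ((colourLists d.1).getD c []) ++ modalWord d ws a c ++ w))
    [5, 0, 0, 0]

/-- The word of the fixpoint formula of the state `a`, given the words of the states. -/
def nodeWord (d : Data) (ws : List (List ℕ)) (a : ℕ) : List ℕ :=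
  (if priority d.1 a % 2 = 0 then 6 else 5) :: stateLetter d.1 a :: stepWord d ws a

/-- The list of bound states after pushing `a`. -/
def pushList (t : Table) (B : List ℕ) (a : ℕ) : List ℕ :=
  a :: B.flatMap fun b => if priority t a ≤ priority t b then [b] else []

/-- The word of the unravelling from `a` with bound states `B`, computed to a given depth. The
branches that are cut off there get the empty word. -/
def treeWord (d : Data) : ℕ → List ℕ → ℕ → List ℕ
  | 0, _, _ => []
  | k + 1, B, a =>
    if a ∈ B then [0, stateLetter d.1 a]
    else nodeWord d ((List.range (states d.1)).map (treeWord d k (pushList d.1 B a))) a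

/-- A depth at which no branch of the unravelling is cut off: the total weight of the states, plus
one. -/
def depth (t : Table) : ℕ := t.2.2.1.foldr (fun p k => (states t + 1) ^ p + k) 1

section
variable {α : Type*} [Primcodable α]

open Primrec

theorem primrec_states : Primrec states := list_length.comp (fst.comp (snd.comp snd))

theorem primrec_colourLists : Primrec colourLists := by
  refine list_foldr (f := fun t : Table => t.1) (g := fun _ => [[]])
    (h := fun _ x => x.2.flatMap fun l => [l, x.1 :: l]) fst (const _) ?_
  refine (list_flatMap (f := fun x : Table × ℕ × List (List ℕ) => x.2.2)
    (g := fun x l => [l, x.2.1 :: l]) (snd.comp snd) ?_).to₂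
  exact (list_cons.comp snd (list_cons.comp (list_cons.comp (fst.comp (snd.comp fst)) snd)
    (const []))).to₂

theorem primrec_entry {t : α → Table} {a c : α → ℕ} (ht : Primrec t) (ha : Primrec a)
    (hc : Primrec c) : Primrec fun x => entry (t x) (a x) (c x) :=
  (list_getD 0).comp ((list_getD []).comp (fst.comp (snd.comp ht)) ha) hc

theorem primrec_priority {t : α → Table} {a : α → ℕ} (ht : Primrec t) (ha : Primrec a) :
    Primrec fun x => priority (t x) (a x) :=
  (list_getD 0).comp (fst.comp (snd.comp (snd.comp ht))) ha

theorem primrec_stateLetter {t : α → Table} {a : α → ℕ} (ht : Primrec t) (ha : Primrec a) :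
    Primrec fun x => stateLetter (t x) (a x) :=
  nat_add.comp (nat_add.comp (list_foldr (h := fun _ x => x.1 + x.2) (fst.comp ht) (const 0)
    (nat_add.comp (fst.comp snd) (snd.comp snd)).to₂) (const 1)) ha

theorem primrec_occurs {d : α → Data} {a c b : α → ℕ} (hd : Primrec d) (ha : Primrec a)
    (hc : Primrec c) (hb : Primrec b) : Primrec fun x => occurs (d x) (a x) (c x) (b x) :=
  (list_getD false).comp (snd.comp hd) <| nat_add.comp (nat_mul.comp (nat_add.comp (nat_mul.comp ha
    (list_length.comp (primrec_colourLists.comp (fst.comp hd)))) hc)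
    (primrec_states.comp (fst.comp hd))) hb

theorem primrecPred_mem {a : α → ℕ} {l : α → List ℕ} (ha : Primrec a) (hl : Primrec l) :
    PrimrecPred fun x => a x ∈ l x :=
  (PrimrecRel.comp (PrimrecRel.exists_mem_list (Primrec.eq (α := ℕ))) hl ha).of_eq fun x => by simp

theorem primrec_colourWord {l s : α → List ℕ} (hl : Primrec l) (hs : Primrec s) :
    Primrec fun x => colourWord (l x) (s x) :=
  list_foldr (h := fun x y => 3 :: (if y.1 ∈ s x then 0 else 1) :: y.1 :: y.2) hl (const _)
    (list_cons.comp (const 3) (list_cons.comp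
      (ite (primrecPred_mem (fst.comp snd) (hs.comp fst)) (const 0) (const 1))
      (list_cons.comp (fst.comp snd) (snd.comp snd)))).to₂

theorem primrec_modalWord {d : α → Data} {ws : α → List (List ℕ)} {a c : α → ℕ} (hd : Primrec d)
    (hws : Primrec ws) (ha : Primrec a) (hc : Primrec c) :
    Primrec fun x => modalWord (d x) (ws x) (a x) (c x) := by
  have hn := primrec_states.comp (fst.comp hd)
  refine list_cons.comp (const 4) (list_cons.comp hn (list_cons.comp
    (primrec_entry (fst.comp hd) ha hc) (list_flatMap (list_range.comp hn) ?_)))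
  exact (ite (Primrec.eq.comp (primrec_occurs (hd.comp fst) (ha.comp fst) (hc.comp fst) snd)
    (const true)) ((list_getD []).comp (hws.comp fst) snd) (const [5, 0, 0, 0])).to₂

theorem primrec_stepWord {d : α → Data} {ws : α → List (List ℕ)} {a : α → ℕ} (hd : Primrec d)
    (hws : Primrec ws) (ha : Primrec a) : Primrec fun x => stepWord (d x) (ws x) (a x) := by
  have hC := primrec_colourLists.comp (fst.comp hd)
  refine list_foldr (h := fun x y => 2 :: 3 :: (colourWord (d x).1.1
    ((colourLists (d x).1).getD y.1 []) ++ modalWord (d x) (ws x) (a x) y.1 ++ y.2))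
    (list_range.comp (list_length.comp hC)) (const _) ?_
  have hc : Primrec fun x : α × ℕ × List ℕ => x.2.1 := fst.comp snd
  exact (list_cons.comp (const 2) (list_cons.comp (const 3) (list_append.comp (list_append.comp
    (primrec_colourWord (fst.comp (fst.comp (hd.comp fst)))
      ((list_getD []).comp (hC.comp fst) hc))
    (primrec_modalWord (hd.comp fst) (hws.comp fst) (ha.comp fst) hc)) (snd.comp snd)))).to₂

theorem primrec_nodeWord {d : α → Data} {ws : α → List (List ℕ)} {a : α → ℕ} (hd : Primrec d)
    (hws : Primrec ws) (ha : Primrec a) : Primrec fun x => nodeWord (d x) (ws x) (a x) :=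
  list_cons.comp (ite (Primrec.eq.comp (nat_mod.comp (primrec_priority (fst.comp hd) ha) (const 2))
    (const 0)) (const 6) (const 5)) (list_cons.comp (primrec_stateLetter (fst.comp hd) ha)
    (primrec_stepWord hd hws ha))

theorem primrec_pushList {t : α → Table} {B : α → List ℕ} {a : α → ℕ} (ht : Primrec t)
    (hB : Primrec B) (ha : Primrec a) : Primrec fun x => pushList (t x) (B x) (a x) := by
  refine list_cons.comp ha (list_flatMap
    (g := fun x b => if priority (t x) (a x) ≤ priority (t x) b then [b] else []) hB ?_)
  exact (ite (nat_le.comp (primrec_priority (ht.comp fst) (ha.comp fst))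
    (primrec_priority (ht.comp fst) snd)) (list_cons.comp snd (const [])) (const [])).to₂

theorem primrec_treeWord :
    Primrec₂ fun (d : Data) (b : ℕ × List ℕ × ℕ) => treeWord d b.1 b.2.1 b.2.2 := by
  refine nat_omega_rec _ (m := fun _ b => b.1)
    (l := fun d b => if b.1 = 0 then [] else
      (List.range (states d.1)).map fun c => (b.1 - 1, pushList d.1 b.2.1 b.2.2, c))
    (g := fun d x => some (if x.1.1 = 0 then [] else if x.1.2.2 ∈ x.1.2.1
      then [0, stateLetter d.1 x.1.2.2] else nodeWord d x.2 x.1.2.2)) ?_ ?_ ?_ ?_ ?_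
  · exact (fst.comp snd).to₂
  · have hk : Primrec fun x : Data × ℕ × List ℕ × ℕ => x.2.1 := fst.comp snd
    refine (ite (Primrec.eq.comp hk (const 0)) (const [])
      (list_map (g := fun x c => (x.2.1 - 1, pushList x.1.1 x.2.2.1 x.2.2.2, c))
        (list_range.comp (primrec_states.comp (fst.comp fst))) ?_)).to₂
    have hb : Primrec fun x : (Data × ℕ × List ℕ × ℕ) × ℕ => x.1.2 := snd.comp fst
    exact (pair (pred.comp (fst.comp hb)) (pair (primrec_pushList (fst.comp (fst.comp fst))
      (fst.comp (snd.comp hb)) (snd.comp (snd.comp hb))) snd)).to₂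
  · have ha : Primrec fun x : Data × (ℕ × List ℕ × ℕ) × List (List ℕ) => x.2.1.2.2 :=
      snd.comp (snd.comp (fst.comp snd))
    exact (option_some.comp (ite (Primrec.eq.comp (fst.comp (fst.comp snd)) (const 0)) (const [])
      (ite (primrecPred_mem ha (fst.comp (snd.comp (fst.comp snd))))
        (list_cons.comp (const 0) (list_cons.comp (primrec_stateLetter (fst.comp fst) ha)
          (const []))) (primrec_nodeWord fst (snd.comp snd) ha)))).to₂
  · rintro d ⟨k, B, a⟩ b' hb'
    rcases k with - | k
    · simp at hb'
    · simp only [Nat.add_one_ne_zero, if_false, List.mem_map] at hb'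
      obtain ⟨c, -, rfl⟩ := hb'
      simp
  · rintro d ⟨k, B, a⟩
    rcases k with - | k
    · simp [treeWord]
    · simp [treeWord, Function.comp_def]

theorem primrec_depth : Primrec depth :=
  list_foldr (h := fun (t : Table) x => (states t + 1) ^ x.1 + x.2) (fst.comp (snd.comp snd))
    (const 1) (nat_add.comp ((Primrec₂.unpaired'.1 Nat.Primrec.pow).comp
      (succ.comp (primrec_states.comp fst)) (fst.comp snd)) (snd.comp snd)).to₂

end

/-- The list of truth values that extends a presentation to the data of the translation, where `g`
decides the occurrence of predicates in coded one-step formulas. -/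
def occurrences (g : ℕ × ℕ × ℕ → Bool) (t : Table) : List Bool :=
  (List.range (states t * (colourLists t).length * states t)).map fun i =>
    g (states t, entry t (i / states t / (colourLists t).length)
      (i / states t % (colourLists t).length), i % states t)

theorem computable_map_range {α σ : Type*} [Primcodable α] [Primcodable σ] {f : α → ℕ}
    {g : α → ℕ → σ} (hf : Computable f) (hg : Computable₂ g) :
    Computable fun x => (List.range (f x)).map (g x) := by
  refine (Computable.nat_rec (g := fun _ => ([] : List σ)) (h := fun x y => y.2 ++ [g x y.1]) hf
    (Computable.const []) (Computable.list_concat.comp (Computable.snd.comp Computable.snd)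
      (hg.comp Computable.fst (Computable.fst.comp Computable.snd))).to₂).of_eq fun x => ?_
  induction f x with
  | zero => rfl
  | succ k ih => simp only [ih, List.range_succ, List.map_append, List.map_cons, List.map_nil]

theorem computable_occurrences {g : ℕ × ℕ × ℕ → Bool} (hg : Computable g) :
    Computable (occurrences g) := by
  have hC : Primrec fun t => (colourLists t).length :=
    Primrec.list_length.comp primrec_colourLists
  refine computable_map_range
    (Primrec.nat_mul.comp (Primrec.nat_mul.comp primrec_states hC) primrec_states).to_comp ?_
  have hi : Primrec fun x : Table × ℕ => x.2 / states x.1 :=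
    Primrec.nat_div.comp Primrec.snd (primrec_states.comp Primrec.fst)
  have hC' := hC.comp (Primrec.fst (α := Table) (β := ℕ))
  exact (hg.comp (Primrec.pair (primrec_states.comp Primrec.fst) (Primrec.pair
    (primrec_entry Primrec.fst (Primrec.nat_div.comp hi hC') (Primrec.nat_mod.comp hi hC'))
    (Primrec.nat_mod.comp Primrec.snd (primrec_states.comp Primrec.fst)))).to_comp).to₂

/-- The translation of a presentation. -/
def translate (g : ℕ × ℕ × ℕ → Bool) (t : Table) : List ℕ :=
  treeWord (t, occurrences g t) (depth t) [] t.2.2.2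

theorem computable_translate {g : ℕ × ℕ × ℕ → Bool} (hg : Computable g) :
    Computable (translate g) :=
  primrec_treeWord.to_comp.comp (Computable.pair Computable.id (computable_occurrences hg))
    (Computable.pair primrec_depth.to_comp (Computable.pair (Computable.const [])
      (Primrec.snd.comp (Primrec.snd.comp Primrec.snd)).to_comp))

end Presentation

end OneStepLanguage

namespace OneStepLanguage

open Unravel

variable {L : OneStepLanguage.{u, v}} {P : Finset ℕ}

/-! ### Correctness of the translation on finite presentations -/

theorem foldr_eq_foldr_range {α β : Type*} {l : List α} {f : α → β → β} {g : ℕ → β → β} {b : β}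
    (h : ∀ i (hi : i < l.length) x, f l[i] x = g i x) :
    l.foldr f b = (List.range l.length).foldr g b := by
  conv_lhs => rw [← List.map_get_finRange l]
  rw [← List.map_coe_finRange_eq_range, List.foldr_map, List.foldr_map]
  congr 1
  funext i x
  exact h i i.2 x

theorem flatten_ofFn_eq_flatMap_range {α : Type*} {n : ℕ} {f : Fin n → List α} {g : ℕ → List α}
    (h : ∀ i : Fin n, f i = g i) : (List.ofFn f).flatten = (List.range n).flatMap g := by
  rw [← List.map_coe_finRange_eq_range, List.flatMap_map, List.ofFn_eq_map, ← List.flatMap_def]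
  exact congrArg (fun k => (List.finRange n).flatMap k) (funext h)

namespace Automaton

open Presentation

variable (A : L.Automaton P) (e : L.Coding)

theorem states_table : states (A.table e) = A.n := by simp [states, table]

theorem length_colours : (colours P).length = (colourLists (A.table e)).length := by
  simp [colours, colourLists, table]

theorem priority_table (a : Fin A.n) : priority (A.table e) a = A.Ω a := by
  simp [priority, table, List.getD_eq_getElem?_getD]

theorem stateLetter_table (a : Fin A.n) : stateLetter (A.table e) a = stateVar P a := by
  rw [stateLetter, stateVar, offset, List.sum]
  rfl

theorem entry_table (a : Fin A.n) {c : ℕ} (hc : c < (colours P).length) :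
    entry (A.table e) a c = e.code (A.Δ a (colours P)[c]) := by
  simp [entry, table, List.getD_eq_getElem?_getD, hc]

theorem occurs_table {g : ℕ × ℕ × ℕ → Bool}
    (hg : ∀ (n : ℕ) (α : L.Form n) (i : Fin n), g (n, e.code α, (i : ℕ)) = true ↔ i ∈ L.occ α)
    (a b : Fin A.n) {c : ℕ} (hc : c < (colours P).length) :
    occurs (A.table e, occurrences g (A.table e)) a c b = true ↔
      b ∈ L.occ (A.Δ a (colours P)[c]) := by
  have ha := a.2
  have hb := b.2
  have hn : 0 < A.n := by omega
  have hC : 0 < (colours P).length := by omega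
  have hlt : (a * (colours P).length + c) * A.n + b < A.n * (colours P).length * A.n := by
    have h1 : (a : ℕ) * (colours P).length + c + 1 ≤ A.n * (colours P).length := by
      have := Nat.mul_le_mul_right (colours P).length ha
      rw [Nat.succ_mul] at this
      omega
    have := Nat.mul_le_mul_right A.n h1
    rw [Nat.succ_mul] at this
    omega
  have hdiv : ((a * (colours P).length + c) * A.n + b) / A.n = a * (colours P).length + c := by
    rw [Nat.mul_comm, Nat.mul_add_div hn, Nat.div_eq_of_lt hb, Nat.add_zero]
  have hmod : ((a * (colours P).length + c) * A.n + b) % A.n = b := by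
    rw [Nat.mul_comm, Nat.mul_add_mod, Nat.mod_eq_of_lt hb]
  have hdiv' : (a * (colours P).length + c) / (colours P).length = (a : ℕ) := by
    rw [Nat.mul_comm, Nat.mul_add_div hC, Nat.div_eq_of_lt hc, Nat.add_zero]
  have hmod' : (a * (colours P).length + c) % (colours P).length = c := by
    rw [Nat.mul_comm, Nat.mul_add_mod, Nat.mod_eq_of_lt hc]
  rw [← hg, occurs, occurrences, states_table, ← length_colours, List.getD_eq_getElem?_getD,
    List.getElem?_map, List.getElem?_range hlt]
  simp only [Option.map_some, Option.getD_some, hdiv, hmod, hdiv', hmod', entry_table A e a hc]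

theorem word_colourFml (c : P.powerset) {s : List ℕ} (hs : ∀ p, p ∈ s ↔ p ∈ c.1) :
    (colourFml L P c).word e = colourWord (P.sort (· ≤ ·)) s := by
  rw [colourFml, colourWord]
  induction P.sort (· ≤ ·) with
  | nil => rfl
  | cons p l ih =>
    rw [List.foldr_cons, List.foldr_cons, Fml.word, ih]
    simp only [hs]
    split_ifs <;> rfl

theorem mem_getD_colourLists {c : ℕ} (hc : c < (colours P).length) (p : ℕ) :
    p ∈ (colourLists (A.table e)).getD c [] ↔ p ∈ ((colours P)[c]).1 := by
  have hc' : c < (P.sort (· ≤ ·)).sublists.length := by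
    rw [length_colours A e] at hc
    exact hc
  simp only [colours, colourLists, table, List.getD_eq_getElem?_getD, List.getElem_map,
    List.getElem_attach, List.mem_toFinset, List.getElem?_eq_getElem hc', Option.getD_some]

theorem word_stepFml {g : ℕ × ℕ × ℕ → Bool}
    (hg : ∀ (n : ℕ) (α : L.Form n) (i : Fin n), g (n, e.code α, (i : ℕ)) = true ↔ i ∈ L.occ α)
    (a : Fin A.n) {φ : Fin A.n → L.Fml} {ws : List (List ℕ)}
    (hws : ∀ b : Fin A.n, ws.getD b [] = (φ b).word e) :
    (A.stepFml a φ).word e = stepWord (A.table e, occurrences g (A.table e)) ws a := by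
  have hmodal : ∀ c (hc : c < (colours P).length),
      (Fml.nxt (A.Δ a (colours P)[c]) (A.trim a (colours P)[c] φ)).word e =
        modalWord (A.table e, occurrences g (A.table e)) ws a c := by
    intro c hc
    rw [Fml.word, modalWord, entry_table A e a hc, states_table]
    congr 3
    refine flatten_ofFn_eq_flatMap_range fun b => ?_
    have hocc := occurs_table A e hg a b hc
    by_cases hb : b ∈ L.occ (A.Δ a (colours P)[c])
    · rw [trim, if_pos hb, if_pos (hocc.2 hb), hws]
    · rw [trim, if_neg hb, if_neg (mt hocc.1 hb)]
      rfl
  rw [stepWord, ← length_colours, ← foldr_eq_foldr_range (l := colours P) (f := fun c w =>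
    2 :: 3 :: ((colourFml L P c).word e ++ (Fml.nxt (A.Δ a c) (A.trim a c φ)).word e ++ w))]
  · rw [stepFml]
    induction colours P with
    | nil => rfl
    | cons c l ih =>
      rw [List.foldr_cons, List.foldr_cons, Fml.word, Fml.word, ih]
      simp
  · intro c hc w
    rw [hmodal c hc, word_colourFml e _ (mem_getD_colourLists A e hc)]
    rfl

theorem mem_pushList {B : Finset (Fin A.n)} {l : List ℕ} (hl : ∀ b : Fin A.n, (b : ℕ) ∈ l ↔ b ∈ B)
    (a b : Fin A.n) : (b : ℕ) ∈ pushList (A.table e) l a ↔ b ∈ push A.Ω B a := by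
  have h : ∀ x, (b : ℕ) ∈ (if priority (A.table e) a ≤ priority (A.table e) x then [x] else []) ↔
      (b : ℕ) = x ∧ A.Ω a ≤ A.Ω b := by
    intro x
    split_ifs with hx
    · rw [List.mem_singleton]
      refine ⟨?_, And.left⟩
      rintro rfl
      rw [priority_table, priority_table] at hx
      exact ⟨rfl, hx⟩
    · simp only [List.not_mem_nil, false_iff, not_and]
      rintro rfl
      rwa [priority_table, priority_table] at hx
  simp only [pushList, List.mem_cons, List.mem_flatMap, h, push, Finset.mem_insert,
    Finset.mem_filter, Fin.ext_iff, ← hl]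
  refine or_congr_right ⟨?_, ?_⟩
  · rintro ⟨x, hx, rfl, hle⟩
    exact ⟨hx, hle⟩
  · rintro ⟨hb, hle⟩
    exact ⟨b, hb, rfl, hle⟩

/-- The recursion on words computes the formula as soon as the depth exceeds the weight that the
bound states can still gain. -/
theorem treeWord_table {g : ℕ × ℕ × ℕ → Bool}
    (hg : ∀ (n : ℕ) (α : L.Form n) (i : Fin n), g (n, e.code α, (i : ℕ)) = true ↔ i ∈ L.occ α)
    (k : ℕ) (B : Finset (Fin A.n)) (hk : weight A.Ω Finset.univ < k + weight A.Ω B) {l : List ℕ}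
    (hl : ∀ b : Fin A.n, (b : ℕ) ∈ l ↔ b ∈ B) (a : Fin A.n) :
    treeWord (A.table e, occurrences g (A.table e)) k l a = (A.treeFml B a).word e := by
  induction k generalizing B l a with
  | zero => exact absurd hk (by have := weight_le_univ A.Ω B; omega)
  | succ k ih =>
    by_cases ha : a ∈ B
    · rw [treeWord, if_pos ((hl a).2 ha), treeFml_of_mem ha, Fml.word, stateLetter_table]
    · have hws : ∀ b : Fin A.n, ((List.range A.n).map (treeWord (A.table e,
          occurrences g (A.table e)) k (pushList (A.table e) l a))).getD b [] =
          (A.treeFml (push A.Ω B a) b).word e := by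
        intro b
        rw [← ih (push A.Ω B a) (by have := weight_lt_weight_push A.Ω ha; omega)
          (mem_pushList A e hl a) b]
        simp [List.getD_eq_getElem?_getD]
      rw [treeWord, if_neg (mt (hl a).1 ha), treeFml_of_notMem ha, nodeWord, states_table,
        ← word_stepFml A e hg a hws, stateLetter_table, priority_table, fixFml]
      simp only [← Nat.even_iff]
      split_ifs <;> rfl

theorem depth_table : depth (A.table e) = weight A.Ω Finset.univ + 1 := by
  have h : ∀ l : List ℕ, l.foldr (fun p k => (A.n + 1) ^ p + k) 1 =
      (l.map fun p => (A.n + 1) ^ p).sum + 1 := by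
    intro l
    induction l with
    | nil => rfl
    | cons p l ih => rw [List.foldr_cons, ih, List.map_cons, List.sum_cons, Nat.add_assoc]
  rw [depth, states_table]
  refine (h _).trans ?_
  rw [weight, table, List.map_ofFn, List.sum_ofFn]
  rfl

theorem translate_table {g : ℕ × ℕ × ℕ → Bool}
    (hg : ∀ (n : ℕ) (α : L.Form n) (i : Fin n), g (n, e.code α, (i : ℕ)) = true ↔ i ∈ L.occ α) :
    translate g (A.table e) = (A.treeFml ∅ A.init).word e :=
  treeWord_table A e hg _ ∅ (by rw [depth_table]; omega) (by simp) A.init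

end Automaton

end OneStepLanguage

theorem mainTheorem11 (L : OneStepLanguage.{u, v}) :
    ∃ ξ : (P : Finset ℕ) → L.Automaton P → L.Fml,
      (∀ e : L.Coding, OneStepLanguage.Effective e ξ) ∧
      ∀ (P : Finset ℕ) (A : L.Automaton P),
        (ξ P A).IsMu ∧ (ξ P A).FV ⊆ (P : Set ℕ) ∧
        (∀ S : LTS.{u} P, (ξ P A).Holds S ↔ A.Accepts S) ∧
        (A.IsWeak → (ξ P A).IsMuD) ∧
        (A.IsWeakContinuous → (ξ P A).IsMuC) := by
  refine ⟨fun P A => A.treeFml ∅ A.init, fun e => ?_, fun P A => ⟨?_, ?_, ?_, ?_, ?_⟩⟩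
  · obtain ⟨g, hg, hocc⟩ := e.occ_computable
    exact ⟨OneStepLanguage.Presentation.translate g,
      OneStepLanguage.Presentation.computable_translate hg,
      fun P A => A.translate_table e hocc⟩
  · exact OneStepLanguage.Automaton.isMu_treeFml ∅ A.init
  · refine (OneStepLanguage.Automaton.FV_treeFml ∅ A.init).trans ?_
    simp
  · exact OneStepLanguage.Automaton.holds_treeFml_iff
  · exact fun hA => OneStepLanguage.Automaton.isMuD_treeFml hA ∅ A.init
  · exact fun hA => OneStepLanguage.Automaton.isMuC_treeFml hA ∅ A.init
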